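/- **Setting.** Let $(M,d)$ be a compact connected metric space with Borel $\sigma$-algebra whose distance is geodesic, i.e. for all $x,y\in M$ and $0\le t\le d(x,y)$ there is $z$ with $d(x,z)=t$ and $d(z,y)=d(x,y)-t$ (for instance a compact connected manifold with its Riemannian distance). Let $(X,\mathcal A,\mathbb P)$ be a probability space and $\theta:X\to X$ an invertible bimeasurable transformation for which $\mathbb P$ is invariant and ergodic. For each $w\in X$ let $f_w:M\to M$ be a local homeomorphism such that $(w,x)\mapsto f_w(x)$ is measurable, and put $f_w^0=\mathrm{id}$, $f^n_w=f_{\theta^{n-1}(w)}\circ\dots\circ f_{\theta(w)}\circ f_w$, $F(w,x)=(\theta(w),f_w(x))$. Let $\deg f_w$ be the number of preimages $\#f_w^{-1}(x)$ (independent of $x$), and assume $\sup_w\deg f_w<\infty$. Assume that there are continuous functions $x\mapsto L_w(x)$ such that every $x\in M$ has a neighbourhood $U_x$ on which $f_w$ is injective with $d(y,z)\le L_w(x)\,d(f_w(y),f_w(z))$ for $y,z\in U_x$. Assume that for each $w\in X$ there are an open set $\mathcal A_w\subset M$, constants $\sigma_w>1$ and $1\le L_w\le 2$, and an integer $0\le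 q_w<\deg f_w$ such that (I) $L_w(x)\le L_w$ for $x\in\mathcal A_w$ and $L_w(x)<\sigma_w^{-1}$ for $x\notin\mathcal A_w$; (II) $M$ has a finite cover by open sets on which $f_w$ is injective, $q_w$ of which cover $\mathcal A_w$; (III) for every $r>0$ there is an integer $\tilde n=\tilde n(w,r)\ge1$ with $f^{\tilde n}_{\theta^j(w)}\big(B(f_w^j(x),r)\big)=M$ for all $j\ge0$ and $x\in M$. Let $\alpha>0$ and let $\phi:X\times M\to\mathbb R$ be measurable, with $\phi_w=\phi(w,\cdot)$ $\alpha$-Hölder for each $w$ and $\int\|\phi_w\|_\infty\,d\mathbb P(w)<\infty$. Assume that there is $\varepsilon_\phi>0$ such that for all $w\in X$ (IV) $\sup\phi_w-\inf\phi_w+\varepsilon_\phi<\log\deg f_w-\log q_w$ (no restriction if $q_w=0$) and $|e^{\phi_w}|_\alpha<\varepsilon_\phi e^{\inf\phi_w}$, where $|\psi|_\alpha=\sup_{x\ne y}|\psi(x)-\psi(y)|/d(x,y)^\alpha$. Fix $\delta>0$ and let $m\ge1$ be a constant such that, for every $C>0$, every function $\psi:M\to\mathbb R$ with $|\psi(x)-\psi(y)|\le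 C\,d(x,y)^\alpha$ whenever $d(x,y)<\delta$ satisfies $|\psi(x)-\psi(y)|\le Cm\,d(x,y)^\alpha$ for all $x,y$. Assume finally that there is $\gamma<1$ such that, with $p_w=\deg f_w-q_w$, for all $w\in X$ (V) $\displaystyle e^{\varepsilon_\phi}\,\frac{p_w\sigma_w^{-\alpha}+q_wL_w^\alpha\big(1+(L_w-1)^\alpha\big)}{\deg f_w}+\varepsilon_\phi L_w^\alpha\big[1+m(\operatorname{diam}M)^\alpha\big]\le\gamma .$ Let $\mathcal L_w\psi(x)=\sum_{y\in f_w^{-1}(x)}e^{\phi_w(y)}\psi(y)$ be the transfer operator, and define $\mathcal L_w^*\rho$, for a finite Borel measure $\rho$, by $\int\psi\,d(\mathcal L_w^*\rho)=\int\mathcal L_w\psi\,d\rho$ for continuous $\psi$. **Theorem A.** (1) There is a measurable family of Borel probabilities $\{\nu_w\}_{w\in X}$ on $M$, unique up to a $\mathbb P$-null set of $w$, such that for almost every $w\in X$ $$\mathcal L_w^*\nu_{\theta(w)}=\lambda_w\nu_w,\qquad \lambda_w=\nu_{\theta(w)}(\mathcal L_w1).$$ (2) There is a family of functions $h_w:M\to\mathbb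 R$ with $(w,x)\mapsto h_w(x)$ measurable such that $h_w$ is $\alpha$-Hölder for almost every $w$, $R^{-1}\le h_w\le R$ for almost every $w$ with a constant $R>0$ independent of $w$, and for almost every $w$ $$\mathcal L_wh_w=\lambda_wh_{\theta(w)},\qquad \nu_w(h_w)=1 .$$ It is unique up to a $\mathbb P$-null set of $w$, even among all jointly measurable families satisfying the last two equations for almost every $w$ whose members, for almost every $w$, are Hölder continuous (with some exponent) and bounded away from $0$ and $\infty$, with exponents and bounds that may depend on $w$. (3) With $\mu_w=h_w\nu_w$, the measure $\mu$ on $X\times M$ given by $d\mu(w,x)=d\mu_w(x)\,d\mathbb P(w)$ is a probability with marginal $\mathbb P$ on $X$, and it is $F$-invariant. -/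

import Mathlib

open MeasureTheory ProbabilityTheory Set
open scoped NNReal ENNReal ProbabilityTheory

noncomputable section

namespace RandomTransfer

variable {X M : Type*}

/-- The fibre iterates `f_w^n = f_{θ^{n-1} w} ∘ ⋯ ∘ f_{θ w} ∘ f_w`, with `f_w^0 = id`. -/
def fiberIter (θ : X → X) (f : X → M → M) : ℕ → X → M → M
  | 0, _ => id
  | n + 1, w => fiberIter θ f n (θ w) ∘ f w

/-- The skew product `F (w, x) = (θ w, f_w x)`. -/
def skewProduct (θ : X → X) (f : X → M → M) (p : X × M) : X × M :=
  (θ p.1, f p.1 p.2)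

/-- The degree of `g`: the number of preimages of a point. For a local homeomorphism of a
compact connected space this number is finite and the same for all points, so that the supremum
is over a constant family. -/
def degree (g : M → M) : ℕ := ⨆ x : M, (g ⁻¹' {x}).ncard

/-- The transfer operator `ψ ↦ (x ↦ ∑_{y ∈ g⁻¹(x)} e^{φ(y)} ψ(y))` of a map `g` with finite
fibres and a potential `φ`. -/
def transfer (g : M → M) (φ ψ : M → ℝ) (x : M) : ℝ :=
  ∑ᶠ y ∈ g ⁻¹' {x}, Real.exp (φ y) * ψ y

/-- The distance of `M` is geodesic (intrinsic): between any two points there are points at all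
intermediate distances, as for the Riemannian distance of a compact connected manifold. -/
def IsGeodesicDist (M : Type*) [MetricSpace M] : Prop :=
  ∀ x y : M, ∀ t ∈ Icc (0 : ℝ) (dist x y), ∃ z : M, dist x z = t ∧ dist z y = dist x y - t

/-- `m ≥ 1` is a constant such that every function which is `(C, α)`-Hölder in balls of radius
`δ` is `(C m, α)`-Hölder on all of `M`. -/
def IsHolderGlobalConst (M : Type*) [MetricSpace M] (δ : ℝ) (α : ℝ≥0) (m : ℝ) : Prop :=
  1 ≤ m ∧ ∀ (C : ℝ) (ψ : M → ℝ), 0 < C →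
    (∀ x y : M, dist x y < δ → |ψ x - ψ y| ≤ C * dist x y ^ (α : ℝ)) →
      ∀ x y : M, |ψ x - ψ y| ≤ C * m * dist x y ^ (α : ℝ)

/-- A random dynamical system of local homeomorphisms of `M` over `θ`, of bounded degree, whose
inverse branches at `x` are locally Lipschitz with constant `Lip w x`, continuous in `x`. -/
structure IsRandomLocalHomeo [MeasurableSpace X] [MetricSpace M] [MeasurableSpace M]
    (f : X → M → M) (Lip : X → M → ℝ) : Prop where
  measurable : Measurable (fun p : X × M => f p.1 p.2)
  localHomeo : ∀ w, IsLocalHomeomorph (f w)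
  lip_continuous : ∀ w, Continuous (Lip w)
  inverse_lipschitz : ∀ w x, ∃ U ∈ nhds x, InjOn (f w) U ∧
    ∀ y ∈ U, ∀ z ∈ U, dist y z ≤ Lip w x * dist (f w y) (f w z)
  degree_bounded : BddAbove (range fun w => degree (f w))

/-- Conditions (I), (II), (III) on the generating maps: `A w` is the open region where expansion
may fail, with constants `σ w > 1` and `L w ≥ 1` close to `1`. -/
structure IsNonUniformlyExpanding [MetricSpace M] (θ : X → X) (f : X → M → M)
    (Lip : X → M → ℝ) (A : X → Set M) (σ L : X → ℝ) (q : X → ℕ) : Prop where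
  isOpen_region : ∀ w, IsOpen (A w)
  one_lt_sigma : ∀ w, 1 < σ w
  one_le_L : ∀ w, 1 ≤ L w
  L_le_two : ∀ w, L w ≤ 2
  lip_le_on_region : ∀ w, ∀ x ∈ A w, Lip w x ≤ L w
  lip_lt_off_region : ∀ w, ∀ x ∉ A w, Lip w x < (σ w)⁻¹
  q_lt_degree : ∀ w, q w < degree (f w)
  covering : ∀ w, ∃ 𝒰 : Finset (Set M), (∀ U ∈ 𝒰, IsOpen U ∧ InjOn (f w) U) ∧
    ⋃₀ (𝒰 : Set (Set M)) = univ ∧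
    ∃ 𝒱 : Finset (Set M), 𝒱 ⊆ 𝒰 ∧ 𝒱.card = q w ∧ A w ⊆ ⋃₀ (𝒱 : Set (Set M))
  exact : ∀ w, ∀ r > (0 : ℝ), ∃ n : ℕ, 0 < n ∧ ∀ (j : ℕ) (x : M),
    fiberIter θ f n (θ^[j] w) '' Metric.ball (fiberIter θ f j w x) r = univ

/-- The space `L¹_P(X, C^α(M))` of measurable potentials with `α`-Hölder fibres and integrable
fibrewise sup norm. -/
structure IsHolderPotential [MeasurableSpace X] [MetricSpace M] [MeasurableSpace M]
    (P : Measure X) (α : ℝ≥0) (φ : X → M → ℝ) : Prop where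
  measurable : Measurable (fun p : X × M => φ p.1 p.2)
  holder : ∀ w, MemHolder α (φ w)
  integrable : Integrable (fun w => ⨆ x, |φ w x|) P

/-- Condition (IV), small variation. The first inequality is
`sup φ_w - inf φ_w + ε < log deg f_w - log q_w`, written without logarithms so that it has its
proper meaning (no restriction) also for `q_w = 0`. The second one is
`|e^{φ_w}|_α < ε e^{inf φ_w}`. -/
def IsSmallVariation [MetricSpace M] (f : X → M → M) (q : X → ℕ) (α : ℝ≥0) (ε : ℝ)
    (φ : X → M → ℝ) : Prop :=
  ∀ w, (q w : ℝ) * Real.exp ((⨆ x, φ w x) - (⨅ x, φ w x) + ε) < (degree (f w) : ℝ) ∧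
    eHolderNorm α (fun x => Real.exp (φ w x)) < ENNReal.ofReal (ε * Real.exp (⨅ x, φ w x))

/-- The number `γ_w` of condition (V), as a function of `deg f_w`, `q_w`, `σ_w`, `L_w`, `α`, `ε`,
`m` and the diameter `D` of `M`; here `p_w = deg f_w - q_w`. -/
def coneConst (deg q : ℕ) (σ L : ℝ) (α : ℝ≥0) (ε m D : ℝ) : ℝ :=
  Real.exp ε * ((((deg : ℝ) - q) * σ ^ (-(α : ℝ))
      + q * L ^ (α : ℝ) * (1 + (L - 1) ^ (α : ℝ))) / deg)
    + ε * L ^ (α : ℝ) * (1 + m * D ^ (α : ℝ))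

/-- `λ_w = ν_{θ w}(L_w 1)`. -/
def eigenvalue [MeasurableSpace X] [MeasurableSpace M] (θ : X → X) (f : X → M → M)
    (φ : X → M → ℝ) (ν : Kernel X M) (w : X) : ℝ :=
  ∫ x, transfer (f w) (φ w) (fun _ => 1) x ∂(ν (θ w))

/-- `L_w^* ν_{θ w} = λ_w ν_w` for almost every `w`, where the dual operator is given by
`∫ ψ d(L_w^* ρ) = ∫ L_w ψ dρ` for continuous `ψ`. -/
def IsReferenceFamily [MeasurableSpace X] [TopologicalSpace M] [MeasurableSpace M]
    (P : Measure X) (θ : X → X) (f : X → M → M) (φ : X → M → ℝ) (ν : Kernel X M) : Prop :=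
  ∀ᵐ w ∂P, ∀ ψ : C(M, ℝ),
    ∫ x, transfer (f w) (φ w) ψ x ∂(ν (θ w)) = eigenvalue θ f φ ν w * ∫ x, ψ x ∂(ν w)

/-- `L_w h_w = λ_w h_{θ w}` and `ν_w(h_w) = 1` for almost every `w`. -/
def IsInvariantDensity [MeasurableSpace X] [MeasurableSpace M]
    (P : Measure X) (θ : X → X) (f : X → M → M) (φ : X → M → ℝ) (ν : Kernel X M)
    (h : X → M → ℝ) : Prop :=
  ∀ᵐ w ∂P, (∀ x, transfer (f w) (φ w) (h w) x = eigenvalue θ f φ ν w * h (θ w) x) ∧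
    ∫ x, h w x ∂(ν w) = 1

/-- The measure on `X × M` with marginal weight `P` and fibres `μ_w = h_w ν_w`. -/
def fiberMeasure [MeasurableSpace X] [MeasurableSpace M] (P : Measure X) (ν : Kernel X M)
    [IsSFiniteKernel ν] (h : X → M → ℝ) : Measure (X × M) :=
  P ⊗ₘ (ν.withDensity fun w x => ENNReal.ofReal (h w x))

end RandomTransfer

end

/-! Single inverse branches may expand distances, but on average they contract. A fibre of `f w` has
at most `q w` points in the region `A w`, so over a short step the fibres above the two endpoints
can be matched with total distance at most `(deg - q) σ⁻¹ + q L` times the step. Short steps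
concatenate along geodesics (`hasPairing_of_covering`). Since `e^φ` varies little, the bound on
`coneConst` by a number below one turns this into `MeanContracting`, uniformly in the fibre.

`LogCone` is made for such a mean contraction: its modulus contains the factor `inf ψ / ψ(x)`. In
`Lψ(x)` the branch `aᵢ` has weight proportional to `e^{φ(aᵢ)} ψ(aᵢ)`; the factor cancels `ψ(aᵢ)` and
leaves the weighted sum of distances that is known to contract. Jensen's inequality for `log` and
for `t ↦ t^β` then gives the new cone constant `γ^β (E B + C)`, where `B` measures the oscillation
of `ψ` (`LogCone.transfer`). As `B ≤ a C + const` with `a` as small as desired (`LogCone.rpow_le`),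
cone constants follow a map `C ↦ κ C + b` with `κ < 1` (`exists_affine_logCone`).

Hence every cone enters a fixed one after a time independent of the fibre. A coupling argument
follows: removing a definite fraction of one cone function from another costs a bounded amount of
regularity, which is regained after `N` steps, so each block of `N` steps removes a fixed fraction
of the difference (`exists_contractsCone`).

This uniform loss of memory yields the theorem. The quotients `Lⁿψ(x₀) / Lⁿ1(x₀)` converge; their
limit is `∫ ψ dν_w`, and any family satisfying the duality must have these integrals. The densities
are limits of normalized `Lⁿ1` started at `θ⁻ⁿ w`. Another density may have regularity depending on
the fibre, but by Poincaré recurrence for `θ⁻¹` it lies in one fixed cone at infinitely many past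
times, which suffices for uniqueness. Invariance of `μ` comes from `L(ψ ∘ f · h) = ψ · L h`.

If `α > 1`, Hölder functions on a geodesic space are constant, and the same argument runs with
exponent `1` and rate `γ^{1/α}`. -/

open Filter Topology

namespace RandomTransfer

/-! ### Fibres of local homeomorphisms and their matchings -/

section Fibers

variable {M : Type*}

/-- `a` enumerates the fibre of `g` over `x` without repetition. -/
def IsFiberEnum (g : M → M) (x : M) {n : ℕ} (a : Fin n → M) : Prop :=
  Function.Injective a ∧ range a = g ⁻¹' {x}

theorem IsFiberEnum.apply {g : M → M} {x : M} {n : ℕ} {a : Fin n → M} (h : IsFiberEnum g x a)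
    (i : Fin n) : g (a i) = x := by
  have : a i ∈ g ⁻¹' {x} := h.2 ▸ mem_range_self i
  exact this

theorem IsFiberEnum.transfer_eq {g : M → M} {x : M} {n : ℕ} {a : Fin n → M}
    (h : IsFiberEnum g x a) (φ ψ : M → ℝ) :
    transfer g φ ψ x = ∑ i, Real.exp (φ (a i)) * ψ (a i) := by
  unfold transfer
  rw [← h.2, finsum_mem_range h.1, finsum_eq_sum_of_fintype]

theorem IsFiberEnum.ncard_eq {g : M → M} {x : M} {n : ℕ} {a : Fin n → M}
    (h : IsFiberEnum g x a) : (g ⁻¹' {x}).ncard = n := by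
  rw [← h.2, ← image_univ, ncard_image_of_injective _ h.1, ncard_univ, Nat.card_fin]

theorem IsFiberEnum.exists_perm {g : M → M} {x : M} {n : ℕ} {a b : Fin n → M}
    (ha : IsFiberEnum g x a) (hb : IsFiberEnum g x b) :
    ∃ τ : Equiv.Perm (Fin n), ∀ i, b i = a (τ i) := by
  have hmem : ∀ i, ∃ j, a j = b i := fun i => by
    have : b i ∈ range a := by rw [ha.2, ← hb.2]; exact mem_range_self i
    exact this
  choose τ hτ using hmem
  have hinj : Function.Injective τ := fun i j hij => hb.1 (by rw [← hτ i, ← hτ j, hij])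
  exact ⟨Equiv.ofBijective τ (Finite.injective_iff_bijective.1 hinj), fun i => (hτ i).symm⟩

theorem finite_fiber [TopologicalSpace M] [CompactSpace M] [T2Space M] {g : M → M}
    (hg : IsLocalHomeomorph g) (x : M) : (g ⁻¹' {x}).Finite := by
  have hcl : IsClosed (g ⁻¹' {x}) := isClosed_singleton.preimage hg.continuous
  refine hcl.isCompact.finite (hg.isLocalHomeomorphOn (s := g ⁻¹' {x}) |>.isDiscrete_of_image ?_)
  exact (subsingleton_singleton.anti (image_preimage_subset g {x})).isDiscrete

theorem exists_isFiberEnum [TopologicalSpace M] [CompactSpace M] [T2Space M] {g : M → M}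
    (hg : IsLocalHomeomorph g) (x : M) :
    ∃ a : Fin (g ⁻¹' {x}).ncard → M, IsFiberEnum g x a := by
  have hfin := finite_fiber hg x
  have := hfin.to_subtype
  have e : Fin (g ⁻¹' {x}).ncard ≃ g ⁻¹' {x} :=
    (Finite.equivFinOfCardEq (n := (g ⁻¹' {x}).ncard) rfl).symm
  refine ⟨fun i => e i, Subtype.val_injective.comp e.injective, ?_⟩
  rw [show (fun i => (e i : M)) = Subtype.val ∘ e from rfl, range_comp, e.surjective.range_eq,
    image_univ, Subtype.range_coe]

/-- A fibre of a local homeomorphism of a compact space can be followed to nearby points, inside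
prescribed neighbourhoods of its points. -/
theorem exists_nhds_fiberEnum [TopologicalSpace M] [CompactSpace M] [T2Space M] {g : M → M}
    (hg : IsLocalHomeomorph g) (x : M) (U : M → Set M) (hU : ∀ y, U y ∈ 𝓝 y) {n : ℕ}
    {p : Fin n → M} (hp : IsFiberEnum g x p) :
    ∃ V ∈ 𝓝 x, ∀ y ∈ V, ∃ a : Fin n → M, IsFiberEnum g y a ∧ ∀ i, a i ∈ U (p i) := by
  obtain ⟨S, hS, hdisj⟩ := (finite_fiber hg x).t2_separation
  have hloc : ∀ y, ∃ W, IsOpen W ∧ y ∈ W ∧ InjOn g W := fun y => by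
    exact hg.isLocallyInjective y
  choose W hWo hWm hWi using hloc
  set O : M → Set M := fun y => S y ∩ W y ∩ interior (U y) with hO
  have hOo : ∀ y, IsOpen (O y) := fun y => ((hS y).2.inter (hWo y)).inter isOpen_interior
  have hOm : ∀ y, y ∈ O y := fun y => ⟨⟨(hS y).1, hWm y⟩, mem_interior_iff_mem_nhds.2 (hU y)⟩
  -- Points outside this closed image have all their preimages in the sets `O (p i)`, which excludes
  -- preimages other than the followed ones.
  have hKc : IsClosed (g '' (⋃ i, O (p i))ᶜ) :=
    ((isOpen_iUnion fun i => hOo (p i)).isClosed_compl.isCompact.image hg.continuous).isClosed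
  refine ⟨(⋂ i, g '' O (p i)) ∩ (g '' (⋃ i, O (p i))ᶜ)ᶜ, ?_, ?_⟩
  · refine inter_mem ?_ (hKc.isOpen_compl.mem_nhds ?_)
    · refine (Filter.iInter_mem).2 fun i => ?_
      rw [show x = g (p i) from (hp.apply i).symm]
      exact (hg.isOpenMap _ (hOo _)).mem_nhds ⟨p i, hOm _, rfl⟩
    · rintro ⟨z, hz, hzx⟩
      have : z ∈ range p := by rw [hp.2]; exact hzx
      obtain ⟨i, rfl⟩ := this
      exact hz (mem_iUnion.2 ⟨i, hOm _⟩)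
  · rintro y ⟨hy1, hy2⟩
    have h1 : ∀ i, ∃ z ∈ O (p i), g z = y := fun i => mem_iInter.1 hy1 i
    choose a haO hay using h1
    have hmemp : ∀ i, p i ∈ g ⁻¹' {x} := fun i => hp.2 ▸ mem_range_self i
    refine ⟨a, ⟨fun i j hij => ?_, ?_⟩, fun i => interior_subset (haO i).2⟩
    · by_contra hne
      have := hdisj (hmemp i) (hmemp j) (fun h => hne (hp.1 h))
      exact disjoint_left.1 this (haO i).1.1 (hij ▸ (haO j).1.1)
    · ext z
      constructor
      · rintro ⟨i, rfl⟩; exact hay i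
      · intro hz
        have hz' : z ∈ ⋃ i, O (p i) := by
          by_contra hcon
          exact hy2 ⟨z, hcon, hz⟩
        obtain ⟨i, hi⟩ := mem_iUnion.1 hz'
        exact ⟨i, hWi (p i) (haO i).1.2 hi.1.2 ((hay i).trans (mem_singleton_iff.1 hz).symm)⟩

theorem ncard_fiber_eq_degree [TopologicalSpace M] [CompactSpace M] [T2Space M]
    [ConnectedSpace M] {g : M → M} (hg : IsLocalHomeomorph g) (x : M) :
    (g ⁻¹' {x}).ncard = degree g := by
  have hlc : IsLocallyConstant fun x : M => (g ⁻¹' {x}).ncard := by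
    refine (IsLocallyConstant.iff_eventually_eq _).2 fun x => ?_
    obtain ⟨p, hp⟩ := exists_isFiberEnum hg x
    obtain ⟨V, hV, h⟩ := exists_nhds_fiberEnum hg x (fun _ => univ) (fun _ => univ_mem) hp
    filter_upwards [hV] with y hy
    obtain ⟨a, ha, -⟩ := h y hy
    exact ha.ncard_eq
  have hconst : ∀ y, (g ⁻¹' {y}).ncard = (g ⁻¹' {x}).ncard := fun y =>
    hlc.apply_eq_of_isPreconnected isPreconnected_univ (mem_univ _) (mem_univ _)
  unfold degree
  rw [iSup_congr hconst, ciSup_const]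

theorem exists_isFiberEnum_degree [TopologicalSpace M] [CompactSpace M] [T2Space M]
    [ConnectedSpace M] {g : M → M} (hg : IsLocalHomeomorph g) (x : M) :
    ∃ a : Fin (degree g) → M, IsFiberEnum g x a := by
  obtain ⟨a, ha⟩ := exists_isFiberEnum hg x
  rw [← ncard_fiber_eq_degree hg x]
  exact ⟨a, ha⟩

/-- The fibres over `x` and `y` can be matched at total cost at most `c * dist x y`. -/
def HasPairing [MetricSpace M] (g : M → M) (n : ℕ) (c : ℝ) (x y : M) : Prop :=
  ∃ a b : Fin n → M, IsFiberEnum g x a ∧ IsFiberEnum g y b ∧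
    ∑ i, dist (a i) (b i) ≤ c * dist x y

/-- Pairings can be composed along points lying between each other. -/
theorem HasPairing.trans [MetricSpace M] {g : M → M} {n : ℕ} {c : ℝ} {x y z : M}
    (h₁ : HasPairing g n c x y) (h₂ : HasPairing g n c y z)
    (hd : dist x y + dist y z = dist x z) : HasPairing g n c x z := by
  obtain ⟨a, b, ha, hb, hab⟩ := h₁
  obtain ⟨b', d, hb', hd', hbd⟩ := h₂
  obtain ⟨τ, hτ⟩ := hb'.exists_perm hb
  refine ⟨a, d ∘ τ, ha, ⟨hd'.1.comp τ.injective, ?_⟩, ?_⟩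
  · rw [range_comp, τ.surjective.range_eq, image_univ, hd'.2]
  · calc ∑ i, dist (a i) ((d ∘ τ) i)
        ≤ ∑ i, (dist (a i) (b i) + dist (b' (τ i)) (d (τ i))) :=
          Finset.sum_le_sum fun i _ => by rw [← hτ i]; exact dist_triangle _ _ _
      _ = ∑ i, dist (a i) (b i) + ∑ i, dist (b' i) (d i) := by
          rw [Finset.sum_add_distrib, Equiv.sum_comp τ fun i => dist (b' i) (d i)]
      _ ≤ c * dist x y + c * dist y z := add_le_add hab hbd
      _ = c * dist x z := by rw [← hd]; ring

/-- On a compact geodesic space, locally available pairings give global ones. -/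
theorem hasPairing_of_local [MetricSpace M] [CompactSpace M] (hgeo : IsGeodesicDist M)
    {g : M → M} {n : ℕ} {c : ℝ}
    (hloc : ∀ x, ∃ V ∈ 𝓝 x, ∀ y ∈ V, ∀ z ∈ V, HasPairing g n c y z) (x y : M) :
    HasPairing g n c x y := by
  choose V hV hpair using hloc
  obtain ⟨r, hr, hball⟩ := lebesgue_number_lemma_of_metric (s := (univ : Set M))
    (c := fun x => interior (V x)) isCompact_univ (fun x => isOpen_interior)
    (fun x _ => mem_iUnion.2 ⟨x, mem_interior_iff_mem_nhds.2 (hV x)⟩)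
  have hnear : ∀ x y : M, dist x y < r → HasPairing g n c x y := fun x y hxy => by
    obtain ⟨z, hz⟩ := hball x (mem_univ _)
    exact hpair z x (interior_subset (hz (Metric.mem_ball_self hr))) y
      (interior_subset (hz (by rwa [Metric.mem_ball, dist_comm])))
  have hind : ∀ k : ℕ, ∀ x y : M, dist x y ≤ k * (r / 2) → HasPairing g n c x y := by
    intro k
    induction k with
    | zero =>
      intro x y hxy
      refine hnear x y (lt_of_le_of_lt hxy (by simpa using hr))
    | succ k ih =>
      intro x y hxy
      by_cases hlt : dist x y < r
      · exact hnear x y hlt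
      · push Not at hlt
        -- Peeling off a piece of length `r / 2` shorter than the Lebesgue number leaves exactly
        -- `dist x y - r / 2`, so costs add up without loss in the constant `c`.
        obtain ⟨z, hz1, hz2⟩ := hgeo x y (r / 2) ⟨by linarith, by linarith⟩
        refine (hnear x z (by linarith)).trans (ih z y ?_) (by linarith)
        push_cast at hxy
        linarith
  obtain ⟨k, hk⟩ := exists_nat_ge (dist x y / (r / 2))
  exact hind k x y ((div_le_iff₀ (by linarith)).1 hk)

/-- If at most `q` sets of injectivity cover the region `A`, then a fibre has at most `q` points
in `A`. -/
theorem card_filter_mem_le {g : M → M} {x : M} {n : ℕ} {a : Fin n → M} (ha : IsFiberEnum g x a)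
    {A : Set M} {𝒱 : Finset (Set M)} (hinj : ∀ U ∈ 𝒱, InjOn g U)
    (hA : A ⊆ ⋃₀ (𝒱 : Set (Set M))) [DecidablePred fun i => a i ∈ A] :
    (Finset.univ.filter fun i => a i ∈ A).card ≤ 𝒱.card := by
  classical
  have h : ∀ i, ∃ U, a i ∈ A → U ∈ 𝒱 ∧ a i ∈ U := fun i => by
    by_cases hi : a i ∈ A
    · obtain ⟨U, hU, hiU⟩ := hA hi
      exact ⟨U, fun _ => ⟨hU, hiU⟩⟩
    · exact ⟨∅, fun h => (hi h).elim⟩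
  choose F hF using h
  -- Two fibre points in the same set of injectivity coincide, so choosing a set around each point
  -- is injective.
  refine Finset.card_le_card_of_injOn F (fun i hi => (hF i (Finset.mem_filter.1 hi).2).1) ?_
  intro i hi j hj hij
  have hi' := hF i (Finset.mem_filter.1 hi).2
  have hj' := hF j (Finset.mem_filter.1 hj).2
  refine ha.1 (hinj _ hi'.1 hi'.2 (hij ▸ hj'.2) ?_)
  rw [ha.apply, ha.apply]

/-- The pairing of fibres of a map which contracts inverse branches by `s` off a region `A` and
expands them at most by `L` on `A`. -/
theorem hasPairing_of_covering [MetricSpace M] [CompactSpace M] [ConnectedSpace M]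
    (hgeo : IsGeodesicDist M) {g : M → M} (hg : IsLocalHomeomorph g) {l : M → ℝ}
    (hl : ∀ x, ∃ U ∈ 𝓝 x, InjOn g U ∧ ∀ y ∈ U, ∀ z ∈ U, dist y z ≤ l x * dist (g y) (g z))
    {A : Set M} {s L : ℝ} {q : ℕ} (hsL : s ≤ L) (hon : ∀ x ∈ A, l x ≤ L) (hoff : ∀ x ∉ A, l x ≤ s)
    {𝒱 : Finset (Set M)} (hcard : 𝒱.card = q) (hinj : ∀ U ∈ 𝒱, InjOn g U)
    (hA : A ⊆ ⋃₀ (𝒱 : Set (Set M))) (x y : M) :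
    HasPairing g (degree g) (((degree g : ℝ) - q) * s + q * L) x y := by
  classical
  refine hasPairing_of_local hgeo (fun x => ?_) x y
  choose U hU _ hUl using hl
  obtain ⟨p, hp⟩ := exists_isFiberEnum_degree hg x
  obtain ⟨V, hV, h⟩ := exists_nhds_fiberEnum hg x U hU hp
  refine ⟨V, hV, fun y hy z hz => ?_⟩
  obtain ⟨a, ha, haU⟩ := h y hy
  obtain ⟨b, hb, hbU⟩ := h z hz
  refine ⟨a, b, ha, hb, ?_⟩
  have h1 : ∑ i, dist (a i) (b i) ≤ (∑ i, l (p i)) * dist y z := by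
    rw [Finset.sum_mul]
    refine Finset.sum_le_sum fun i _ => ?_
    have := hUl (p i) (a i) (haU i) (b i) (hbU i)
    rwa [ha.apply, hb.apply] at this
  refine h1.trans (mul_le_mul_of_nonneg_right ?_ dist_nonneg)
  -- Only the Lipschitz constants at the central fibre `p` enter, so it is enough to count the
  -- points of this one fibre lying in `A`.
  have h2 : ∀ i, l (p i) ≤ s + if p i ∈ A then L - s else 0 := fun i => by
    by_cases hi : p i ∈ A
    · simpa [hi] using hon _ hi
    · simpa [hi] using hoff _ hi
  have h3 : ((Finset.univ.filter fun i => p i ∈ A).card : ℝ) ≤ q := by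
    exact_mod_cast hcard ▸ card_filter_mem_le hp hinj hA
  calc ∑ i, l (p i) ≤ ∑ i, (s + if p i ∈ A then L - s else 0) := Finset.sum_le_sum fun i _ => h2 i
    _ = degree g * s + (Finset.univ.filter fun i => p i ∈ A).card * (L - s) := by
        rw [Finset.sum_add_distrib, ← Finset.sum_filter]
        simp [mul_sub]
    _ ≤ degree g * s + q * (L - s) := by
        have := mul_le_mul_of_nonneg_right h3 (sub_nonneg.2 hsL)
        linarith
    _ = _ := by ring

end Fibers

/-! ### Mean contraction and the logarithmic cone -/

section Cone

variable {M : Type*} [MetricSpace M]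

/-- The inverse branches of `g`, weighted by `e^φ`, contract distances on average by `γ`, relative
to the mass `n * lo` that the transfer operator gives at least to every point. -/
structure MeanContracting (g : M → M) (φ : M → ℝ) (γ : ℝ) : Prop where
  continuous : Continuous φ
  exists_pairing : ∃ (n : ℕ) (lo : ℝ), 0 < n ∧ 0 < lo ∧ (∀ x, lo ≤ Real.exp (φ x)) ∧
    ∀ x y, ∃ a b : Fin n → M, IsFiberEnum g x a ∧ IsFiberEnum g y b ∧
      ∑ i, Real.exp (φ (a i)) * dist (a i) (b i) ≤ γ * (n * lo) * dist x y

namespace MeanContracting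

variable {g : M → M} {φ : M → ℝ} {γ : ℝ}

theorem exists_enum (hg : MeanContracting g φ γ) :
    ∃ n : ℕ, 0 < n ∧ ∀ x, ∃ a : Fin n → M, IsFiberEnum g x a := by
  obtain ⟨n, lo, hn, -, -, h⟩ := hg.exists_pairing
  exact ⟨n, hn, fun x => let ⟨a, _, ha, _⟩ := h x x; ⟨a, ha⟩⟩

theorem transfer_add (hg : MeanContracting g φ γ) (ψ₁ ψ₂ : M → ℝ) :
    transfer g φ (fun x => ψ₁ x + ψ₂ x) = fun x => transfer g φ ψ₁ x + transfer g φ ψ₂ x := by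
  obtain ⟨n, -, h⟩ := hg.exists_enum
  ext x
  obtain ⟨a, ha⟩ := h x
  simp only [ha.transfer_eq, mul_add, Finset.sum_add_distrib]

theorem transfer_const_mul (hg : MeanContracting g φ γ) (c : ℝ) (ψ : M → ℝ) :
    transfer g φ (fun x => c * ψ x) = fun x => c * transfer g φ ψ x := by
  obtain ⟨n, -, h⟩ := hg.exists_enum
  ext x
  obtain ⟨a, ha⟩ := h x
  simp only [ha.transfer_eq, Finset.mul_sum]
  exact Finset.sum_congr rfl fun i _ => by ring

theorem transfer_pos (hg : MeanContracting g φ γ) {ψ : M → ℝ} (hψ : ∀ x, 0 < ψ x) (x : M) :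
    0 < transfer g φ ψ x := by
  obtain ⟨n, hn, h⟩ := hg.exists_enum
  obtain ⟨a, ha⟩ := h x
  have : Nonempty (Fin n) := ⟨⟨0, hn⟩⟩
  rw [ha.transfer_eq]
  exact Finset.sum_pos (fun i _ => mul_pos (Real.exp_pos _) (hψ _)) Finset.univ_nonempty

/-- Every weight in the pairing is at least `lo`, so each matched pair is within `γ n dist x y`, and
uniform continuity of `e^φ ψ` can be applied branch by branch. -/
theorem continuous_transfer [CompactSpace M] (hg : MeanContracting g φ γ) {ψ : M → ℝ}
    (hψ : Continuous ψ) : Continuous (transfer g φ ψ) := by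
  obtain ⟨n, lo, hn, hlo, hle, h⟩ := hg.exists_pairing
  have hn' : (0 : ℝ) < n := by exact_mod_cast hn
  have huc : UniformContinuous fun x => Real.exp (φ x) * ψ x :=
    CompactSpace.uniformContinuous_of_continuous ((Real.continuous_exp.comp hg.continuous).mul hψ)
  refine Metric.continuous_iff.2 fun y ε hε => ?_
  obtain ⟨δ, hδ, hδ'⟩ := Metric.uniformContinuous_iff.1 huc (ε / n) (by positivity)
  refine ⟨δ / (|γ| * n + 1), by positivity, fun x hxy => ?_⟩
  obtain ⟨a, b, ha, hb, hab⟩ := h x y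
  have hd : ∀ i, dist (a i) (b i) < δ := fun i => by
    have h1 : lo * dist (a i) (b i) ≤ γ * (n * lo) * dist x y :=
      calc lo * dist (a i) (b i) ≤ Real.exp (φ (a i)) * dist (a i) (b i) :=
            mul_le_mul_of_nonneg_right (hle _) dist_nonneg
        _ ≤ ∑ i, Real.exp (φ (a i)) * dist (a i) (b i) :=
            Finset.single_le_sum (f := fun i => Real.exp (φ (a i)) * dist (a i) (b i))
              (fun i _ => by positivity) (Finset.mem_univ i)
        _ ≤ _ := hab
    have h2 : dist (a i) (b i) ≤ γ * n * dist x y := by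
      refine le_of_mul_le_mul_left (h1.trans_eq ?_) hlo
      ring
    have h3 : dist x y * (|γ| * n + 1) < δ := (lt_div_iff₀ (by positivity)).1 hxy
    have h4 : γ * n * dist x y ≤ |γ| * n * dist x y := by
      gcongr
      exact le_abs_self γ
    have h5 := dist_nonneg (x := x) (y := y)
    nlinarith
  rw [Real.dist_eq, ha.transfer_eq, hb.transfer_eq, ← Finset.sum_sub_distrib]
  have : Nonempty (Fin n) := ⟨⟨0, hn⟩⟩
  calc |∑ i, (Real.exp (φ (a i)) * ψ (a i) - Real.exp (φ (b i)) * ψ (b i))|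
      ≤ ∑ i, |Real.exp (φ (a i)) * ψ (a i) - Real.exp (φ (b i)) * ψ (b i)| :=
        Finset.abs_sum_le_sum_abs _ _
    _ < ∑ _i : Fin n, ε / n := Finset.sum_lt_sum_of_nonempty Finset.univ_nonempty
        fun i _ => by simpa [Real.dist_eq] using hδ' (hd i)
    _ = ε := by simp; field_simp

end MeanContracting

/-- The cone of positive continuous functions `ψ` with
`log ψ(x) - log ψ(y) ≤ C (inf ψ · d(x, y) / ψ(x))^β`. -/
structure LogCone (β C : ℝ) (ψ : M → ℝ) : Prop where
  continuous : Continuous ψ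
  pos : ∀ x, 0 < ψ x
  log_sub_le : ∀ x y, Real.log (ψ x) - Real.log (ψ y) ≤ C * ((⨅ z, ψ z) * dist x y / ψ x) ^ β

section

variable [CompactSpace M] [Nonempty M]

theorem exists_eq_iInf_of_continuous {ψ : M → ℝ} (hψ : Continuous ψ) :
    ∃ z, (⨅ x, ψ x) = ψ z ∧ ∀ x, ψ z ≤ ψ x := by
  obtain ⟨z, hz⟩ := hψ.exists_forall_le_of_hasCompactSupport
    (HasCompactSupport.of_compactSpace ψ)
  exact ⟨z, le_antisymm (ciInf_le ⟨ψ z, by rintro _ ⟨x, rfl⟩; exact hz x⟩ z) (le_ciInf hz), hz⟩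

namespace LogCone

variable {β C : ℝ} {ψ : M → ℝ}

theorem iInf_le (h : LogCone β C ψ) (x : M) : (⨅ z, ψ z) ≤ ψ x := by
  obtain ⟨z, hz, hle⟩ := exists_eq_iInf_of_continuous h.continuous
  rw [hz]
  exact hle x

theorem iInf_pos (h : LogCone β C ψ) : 0 < ⨅ z, ψ z := by
  obtain ⟨z, hz, hle⟩ := exists_eq_iInf_of_continuous h.continuous
  rw [hz]
  exact h.pos z

theorem mono (h : LogCone β C ψ) {C' : ℝ} (hC : C ≤ C') : LogCone β C' ψ :=
  ⟨h.continuous, h.pos, fun x y => (h.log_sub_le x y).trans <| mul_le_mul_of_nonneg_right hC <|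
    Real.rpow_nonneg (div_nonneg (mul_nonneg h.iInf_pos.le dist_nonneg) (h.pos x).le) _⟩

omit [CompactSpace M] [Nonempty M] in
theorem const_mul (h : LogCone β C ψ) {c : ℝ} (hc : 0 < c) : LogCone β C fun x => c * ψ x := by
  refine ⟨continuous_const.mul h.continuous, fun x => mul_pos hc (h.pos x), fun x y => ?_⟩
  rw [← Real.mul_iInf_of_nonneg hc.le, Real.log_mul hc.ne' (h.pos x).ne',
    Real.log_mul hc.ne' (h.pos y).ne', mul_assoc c, mul_div_mul_left _ _ hc.ne']
  linarith [h.log_sub_le x y]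

omit [CompactSpace M] in
theorem const (hC : 0 ≤ C) {c : ℝ} (hc : 0 < c) : LogCone (M := M) β C fun _ => c := by
  refine ⟨continuous_const, fun _ => hc, fun x y => ?_⟩
  rw [sub_self, ciInf_const]
  have := dist_nonneg (x := x) (y := y)
  positivity

/-- The oscillation of a function in the cone grows slower than linearly with `C`. -/
theorem rpow_le (h : LogCone β C ψ) (hβ : 0 < β) (hC : 0 ≤ C) {D : ℝ} (hD : 0 < D)
    (hdist : ∀ x y : M, dist x y ≤ D) {a : ℝ} (ha : 0 < a) (x : M) :
    ψ x ^ β ≤ (a * C + Real.exp (β * D ^ β / a)) * (⨅ z, ψ z) ^ β := by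
  obtain ⟨z, hz, hle⟩ := exists_eq_iInf_of_continuous h.continuous
  have hzp := h.pos z
  have hxp := h.pos x
  have hDβ : 0 < D ^ β := Real.rpow_pos_of_pos hD β
  rw [hz, ← div_le_iff₀ (Real.rpow_pos_of_pos hzp β), ← Real.div_rpow hxp.le hzp.le]
  set t := ψ x / ψ z with ht
  have htp : 0 < t := div_pos hxp hzp
  -- The cone condition between `x` and a minimum point `z`, where the modulus is `dist x z / t`,
  -- bounds `t ^ β log t` and not just `log t`. This extra power is the source of the slow growth.
  have h1 : t ^ β * Real.log t ≤ C * D ^ β := by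
    have h2 := h.log_sub_le x z
    rw [hz, ← Real.log_div hxp.ne' hzp.ne', ← ht] at h2
    have h3 : ψ z * dist x z / ψ x = dist x z / t := by rw [ht]; field_simp
    rw [h3, Real.div_rpow dist_nonneg htp.le] at h2
    have h4 : 0 < t ^ β := Real.rpow_pos_of_pos htp β
    calc t ^ β * Real.log t ≤ t ^ β * (C * (dist x z ^ β / t ^ β)) :=
          mul_le_mul_of_nonneg_left h2 h4.le
      _ = C * dist x z ^ β := by field_simp
      _ ≤ C * D ^ β := by
          gcongr
          exact hdist x z
  by_cases hcase : Real.log t ≤ D ^ β / a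
  · have : t ^ β ≤ Real.exp (β * D ^ β / a) := by
      rw [Real.rpow_def_of_pos htp]
      refine Real.exp_le_exp.2 ?_
      calc Real.log t * β ≤ D ^ β / a * β := mul_le_mul_of_nonneg_right hcase hβ.le
        _ = _ := by ring
    nlinarith [mul_nonneg ha.le hC]
  · push Not at hcase
    have h5 : t ^ β * (D ^ β / a) ≤ C * D ^ β :=
      (mul_le_mul_of_nonneg_left hcase.le (Real.rpow_nonneg htp.le _)).trans h1
    have h6 : t ^ β ≤ a * C := by
      rw [← mul_div_assoc, div_le_iff₀ ha] at h5
      nlinarith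
    linarith [Real.exp_pos (β * D ^ β / a)]

theorem sub_le (h : LogCone β C ψ) (hβ : 0 ≤ β) (hC : 0 ≤ C) (x y : M) :
    ψ x - ψ y ≤ C * ψ x * dist x y ^ β := by
  have hx := h.pos x
  have hy := h.pos y
  have h1 : Real.log (ψ y / ψ x) ≤ ψ y / ψ x - 1 := Real.log_le_sub_one_of_pos (div_pos hy hx)
  rw [Real.log_div hy.ne' hx.ne'] at h1
  have h2 := h.log_sub_le x y
  have h3 : ((⨅ z, ψ z) * dist x y / ψ x) ^ β ≤ dist x y ^ β := by
    refine Real.rpow_le_rpow (div_nonneg (mul_nonneg h.iInf_pos.le dist_nonneg) hx.le) ?_ hβ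
    rw [div_le_iff₀ hx, mul_comm]
    exact mul_le_mul_of_nonneg_left (h.iInf_le x) dist_nonneg
  have h4 : 1 - ψ y / ψ x ≤ C * dist x y ^ β := by
    linarith [mul_le_mul_of_nonneg_left h3 hC]
  calc ψ x - ψ y = ψ x * (1 - ψ y / ψ x) := by field_simp
    _ ≤ ψ x * (C * dist x y ^ β) := mul_le_mul_of_nonneg_left h4 hx.le
    _ = _ := by ring

end LogCone

omit [CompactSpace M] in
/-- Positive Hölder functions lie in the cone. -/
theorem logCone_of_holder {β : ℝ} (hβ : 0 ≤ β) {χ : M → ℝ} (hχ : Continuous χ) {μ S H : ℝ}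
    (hμ : 0 < μ) (hH : 0 ≤ H) (hlow : ∀ x, μ ≤ χ x) (hup : ∀ x, χ x ≤ S)
    (hhol : ∀ x y, χ x - χ y ≤ H * dist x y ^ β) : LogCone β (H / μ * (S / μ) ^ β) χ := by
  have hpos : ∀ x, 0 < χ x := fun x => hμ.trans_le (hlow x)
  refine ⟨hχ, hpos, fun x y => ?_⟩
  have hx := hpos x
  have hy := hpos y
  have hS : 0 < S := hx.trans_le (hup x)
  have hm : μ ≤ ⨅ z, χ z := le_ciInf hlow
  have h1 : Real.log (χ x / χ y) ≤ χ x / χ y - 1 := Real.log_le_sub_one_of_pos (div_pos hx hy)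
  rw [Real.log_div hx.ne' hy.ne'] at h1
  have hdn := dist_nonneg (x := x) (y := y)
  have h2 : χ x / χ y - 1 ≤ H * dist x y ^ β / μ := by
    rw [div_sub_one hy.ne', div_le_div_iff₀ hy hμ]
    have h3 : 0 ≤ H * dist x y ^ β := by positivity
    nlinarith [hhol x y, hlow y]
  -- Replacing the distance by the cone modulus costs the ratio of the upper bound to the lower
  -- bound.
  have h4 : dist x y ^ β ≤ (S / μ) ^ β * ((⨅ z, χ z) * dist x y / χ x) ^ β := by
    have hmpos := hμ.trans_le hm
    rw [← Real.mul_rpow (by positivity) (by positivity)]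
    refine Real.rpow_le_rpow hdn ?_ hβ
    rw [div_mul_div_comm, le_div_iff₀ (by positivity)]
    calc dist x y * (μ * χ x) = μ * χ x * dist x y := by ring
      _ ≤ (⨅ z, χ z) * S * dist x y := by
          gcongr
          exact hup x
      _ = _ := by ring
  calc Real.log (χ x) - Real.log (χ y) ≤ H * dist x y ^ β / μ := h1.trans h2
    _ = H / μ * dist x y ^ β := by ring
    _ ≤ H / μ * ((S / μ) ^ β * ((⨅ z, χ z) * dist x y / χ x) ^ β) := by gcongr
    _ = _ := by ring

/-- The transfer operator maps cones to cones. -/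
theorem LogCone.transfer {β C γ B E : ℝ} {g : M → M} {φ ψ : M → ℝ} (h : LogCone β C ψ)
    (hg : MeanContracting g φ γ) (hβ : 0 < β) (hβ1 : β ≤ 1) (hC : 0 ≤ C) (hγ : 0 ≤ γ)
    (hE : 0 ≤ E) (hφ : ∀ x y, φ x - φ y ≤ E * dist x y ^ β) (hB : 0 ≤ B)
    (hψ : ∀ x, ψ x ^ β ≤ B * (⨅ z, ψ z) ^ β) :
    LogCone β (γ ^ β * (E * B + C)) (transfer g φ ψ) := by
  have hcont := hg.continuous_transfer h.continuous
  refine ⟨hcont, hg.transfer_pos h.pos, fun x y => ?_⟩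
  obtain ⟨n, lo, hn, hlo, hle, hpair⟩ := hg.exists_pairing
  have : Nonempty (Fin n) := ⟨⟨0, hn⟩⟩
  obtain ⟨a, b, ha, hb, hab⟩ := hpair x y
  set m := ⨅ z, ψ z with hm
  have hmpos : 0 < m := h.iInf_pos
  have hminf : n * lo * m ≤ ⨅ z, RandomTransfer.transfer g φ ψ z := by
    refine le_ciInf fun z => ?_
    obtain ⟨c, _, hc, _⟩ := hpair z z
    rw [hc.transfer_eq]
    calc n * lo * m = ∑ _i : Fin n, lo * m := by simp [mul_assoc]
      _ ≤ _ := Finset.sum_le_sum fun i _ =>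
          mul_le_mul (hle _) (h.iInf_le _) hmpos.le (Real.exp_pos _).le
  set A : Fin n → ℝ := fun i => Real.exp (φ (a i)) * ψ (a i) with hA
  set A' : Fin n → ℝ := fun i => Real.exp (φ (b i)) * ψ (b i) with hA'
  have hAp : ∀ i, 0 < A i := fun i => mul_pos (Real.exp_pos _) (h.pos _)
  have hAp' : ∀ i, 0 < A' i := fun i => mul_pos (Real.exp_pos _) (h.pos _)
  rw [ha.transfer_eq, hb.transfer_eq]
  set S := ∑ i, A i with hS
  set T := ∑ i, A' i with hT
  have hSp : 0 < S := Finset.sum_pos (fun i _ => hAp i) Finset.univ_nonempty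
  have hTp : 0 < T := Finset.sum_pos (fun i _ => hAp' i) Finset.univ_nonempty
  have hv0 : ∀ i ∈ Finset.univ, 0 ≤ A i / S := fun i _ => div_nonneg (hAp i).le hSp.le
  have hv1 : ∑ i, A i / S = 1 := by rw [← Finset.sum_div, div_self hSp.ne']
  -- Jensen for the concave logarithm, with weights `A i / S` and values `A' i / A i`, whose mean is
  -- `T / S`.
  have hlog : Real.log S - Real.log T ≤ ∑ i, A i / S * (Real.log (A i) - Real.log (A' i)) := by
    have hJ := strictConcaveOn_log_Ioi.concaveOn.le_map_sum (t := Finset.univ)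
      (w := fun i => A i / S) (p := fun i => A' i / A i) hv0 hv1
      (fun i _ => div_pos (hAp' i) (hAp i))
    simp only [smul_eq_mul] at hJ
    have hsum : ∑ i, A i / S * (A' i / A i) = T / S := by
      rw [hT, Finset.sum_div]
      exact Finset.sum_congr rfl fun i _ => by have := (hAp i).ne'; field_simp
    rw [hsum, Real.log_div hTp.ne' hSp.ne'] at hJ
    have hneg : ∑ i, A i / S * Real.log (A' i / A i) =
        - ∑ i, A i / S * (Real.log (A i) - Real.log (A' i)) := by
      rw [← Finset.sum_neg_distrib]
      exact Finset.sum_congr rfl fun i _ => by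
        rw [Real.log_div (hAp' i).ne' (hAp i).ne']; ring
    linarith
  set u : Fin n → ℝ := fun i => m * dist (a i) (b i) / ψ (a i) with hu
  have hu0 : ∀ i, 0 ≤ u i := fun i =>
    div_nonneg (mul_nonneg hmpos.le dist_nonneg) (h.pos _).le
  -- The variation of `φ` is measured by the distance itself; the oscillation bound `B` converts
  -- this to the smaller quantity `u i`.
  have hterm : ∀ i, Real.log (A i) - Real.log (A' i) ≤ (E * B + C) * u i ^ β := fun i => by
    have hd : dist (a i) (b i) ^ β ≤ B * u i ^ β := by
      rw [hu, Real.div_rpow (mul_nonneg hmpos.le dist_nonneg) (h.pos _).le,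
        Real.mul_rpow hmpos.le dist_nonneg, ← mul_div_assoc,
        le_div_iff₀ (Real.rpow_pos_of_pos (h.pos _) _)]
      calc dist (a i) (b i) ^ β * ψ (a i) ^ β ≤ dist (a i) (b i) ^ β * (B * m ^ β) :=
            mul_le_mul_of_nonneg_left (hψ _) (Real.rpow_nonneg dist_nonneg _)
        _ = _ := by ring
    rw [hA, hA', Real.log_mul (Real.exp_pos _).ne' (h.pos _).ne',
      Real.log_mul (Real.exp_pos _).ne' (h.pos _).ne', Real.log_exp, Real.log_exp]
    have h1 := hφ (a i) (b i)
    have h2 := h.log_sub_le (a i) (b i)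
    have h3 := mul_le_mul_of_nonneg_left hd hE
    rw [add_mul, mul_assoc]
    linarith
  have hconc : ∑ i, A i / S * u i ^ β ≤ (∑ i, A i / S * u i) ^ β := by
    have hJ := (Real.concaveOn_rpow hβ.le hβ1).le_map_sum (t := Finset.univ)
      (w := fun i => A i / S) (p := u) hv0 hv1 (fun i _ => hu0 i)
    simpa only [smul_eq_mul] using hJ
  -- The value `ψ (a i)` cancels between the weight and `u i`, so the mean contraction hypothesis
  -- applies; `n * lo * m` is then absorbed into the infimum of the image.
  have hmean : ∑ i, A i / S * u i ≤
      γ * ((⨅ z, RandomTransfer.transfer g φ ψ z) * dist x y / S) := by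
    have h1 : ∑ i, A i / S * u i = m / S * ∑ i, Real.exp (φ (a i)) * dist (a i) (b i) := by
      rw [Finset.mul_sum]
      refine Finset.sum_congr rfl fun i _ => ?_
      have := (h.pos (a i)).ne'
      simp only [hA, hu]
      field_simp
    rw [h1]
    calc m / S * ∑ i, Real.exp (φ (a i)) * dist (a i) (b i)
        ≤ m / S * (γ * (n * lo) * dist x y) := mul_le_mul_of_nonneg_left hab (by positivity)
      _ = γ * dist x y / S * (n * lo * m) := by ring
      _ ≤ γ * dist x y / S * (⨅ z, RandomTransfer.transfer g φ ψ z) :=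
          mul_le_mul_of_nonneg_left hminf
            (div_nonneg (mul_nonneg hγ dist_nonneg) hSp.le)
      _ = _ := by ring
  have hK : 0 ≤ E * B + C := by positivity
  have hinf0 : 0 ≤ ⨅ z, RandomTransfer.transfer g φ ψ z := le_trans (by positivity) hminf
  calc Real.log S - Real.log T ≤ ∑ i, A i / S * (Real.log (A i) - Real.log (A' i)) := hlog
    _ ≤ ∑ i, A i / S * ((E * B + C) * u i ^ β) :=
        Finset.sum_le_sum fun i hi => mul_le_mul_of_nonneg_left (hterm i) (hv0 i hi)
    _ = (E * B + C) * ∑ i, A i / S * u i ^ β := by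
        rw [Finset.mul_sum]
        exact Finset.sum_congr rfl fun i _ => by ring
    _ ≤ (E * B + C) * (γ * ((⨅ z, RandomTransfer.transfer g φ ψ z) * dist x y / S)) ^ β := by
        refine mul_le_mul_of_nonneg_left (hconc.trans ?_) hK
        exact Real.rpow_le_rpow (Finset.sum_nonneg fun i hi => mul_nonneg (hv0 i hi) (hu0 i))
          hmean hβ.le
    _ = γ ^ β * (E * B + C) * ((⨅ z, RandomTransfer.transfer g φ ψ z) * dist x y / S) ^ β := by
        rw [Real.mul_rpow hγ (div_nonneg (mul_nonneg hinf0 dist_nonneg) hSp.le)]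
        ring

end

end Cone

/-! ### Iterated transfer operators and contraction of the cone -/

section Iterates

variable {X M : Type*}

/-- The iterated transfer operators `L_{θ^{n-1} w} ∘ ⋯ ∘ L_w`. -/
noncomputable def iterTransfer (θ : X → X) (f : X → M → M) (φ : X → M → ℝ) :
    ℕ → X → (M → ℝ) → M → ℝ
  | 0, _, ψ => ψ
  | n + 1, w, ψ => iterTransfer θ f φ n (θ w) (transfer (f w) (φ w) ψ)

theorem iterTransfer_add (θ : X → X) (f : X → M → M) (φ : X → M → ℝ) (m n : ℕ) (w : X)
    (ψ : M → ℝ) : iterTransfer θ f φ (m + n) w ψ =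
      iterTransfer θ f φ n (θ^[m] w) (iterTransfer θ f φ m w ψ) := by
  induction m generalizing w ψ with
  | zero => simp [iterTransfer]
  | succ m ih =>
    rw [Nat.succ_add]
    exact ih (θ w) _

theorem iterTransfer_succ (θ : X → X) (f : X → M → M) (φ : X → M → ℝ) (n : ℕ) (w : X)
    (ψ : M → ℝ) : iterTransfer θ f φ (n + 1) w ψ =
      transfer (f (θ^[n] w)) (φ (θ^[n] w)) (iterTransfer θ f φ n w ψ) := by
  rw [iterTransfer_add]
  rfl

variable [MetricSpace M] {θ : X → X} {f : X → M → M} {φ : X → M → ℝ} {γ : ℝ}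

theorem iterTransfer_fun_add (hg : ∀ w, MeanContracting (f w) (φ w) γ) (n : ℕ) (w : X)
    (ψ₁ ψ₂ : M → ℝ) : iterTransfer θ f φ n w (fun x => ψ₁ x + ψ₂ x) =
      fun x => iterTransfer θ f φ n w ψ₁ x + iterTransfer θ f φ n w ψ₂ x := by
  induction n generalizing w ψ₁ ψ₂ with
  | zero => rfl
  | succ n ih =>
    simp only [iterTransfer, (hg w).transfer_add]
    exact ih _ _ _

theorem iterTransfer_const_mul (hg : ∀ w, MeanContracting (f w) (φ w) γ) (n : ℕ) (w : X) (c : ℝ)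
    (ψ : M → ℝ) : iterTransfer θ f φ n w (fun x => c * ψ x) =
      fun x => c * iterTransfer θ f φ n w ψ x := by
  induction n generalizing w ψ with
  | zero => rfl
  | succ n ih =>
    simp only [iterTransfer, (hg w).transfer_const_mul]
    exact ih _ _

theorem iterTransfer_pos (hg : ∀ w, MeanContracting (f w) (φ w) γ) (n : ℕ) (w : X) {ψ : M → ℝ}
    (hψ : ∀ x, 0 < ψ x) (x : M) : 0 < iterTransfer θ f φ n w ψ x := by
  induction n generalizing w ψ with
  | zero => exact hψ x
  | succ n ih => exact ih _ ((hg w).transfer_pos hψ)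

theorem iterTransfer_lt (hg : ∀ w, MeanContracting (f w) (φ w) γ) (n : ℕ) (w : X)
    {ψ₁ ψ₂ : M → ℝ} (h : ∀ x, ψ₁ x < ψ₂ x) (x : M) :
    iterTransfer θ f φ n w ψ₁ x < iterTransfer θ f φ n w ψ₂ x := by
  have h1 := iterTransfer_pos (θ := θ) hg n w
    (ψ := fun x => ψ₂ x + (-1) * ψ₁ x) (fun x => by linarith [h x]) x
  rw [iterTransfer_fun_add hg, iterTransfer_const_mul hg] at h1
  linarith

theorem continuous_iterTransfer [CompactSpace M] (hg : ∀ w, MeanContracting (f w) (φ w) γ)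
    (n : ℕ) (w : X) {ψ : M → ℝ} (hψ : Continuous ψ) :
    Continuous (iterTransfer θ f φ n w ψ) := by
  induction n generalizing w ψ with
  | zero => exact hψ
  | succ n ih => exact ih _ ((hg w).continuous_transfer hψ)

/-- Writing the iterate at a point as a finite nonnegative combination of point evaluations gives
positivity for arbitrary functions, and later the measures whose limit is `ν w`. -/
theorem exists_iterTransfer_eq_sum (hg : ∀ w, MeanContracting (f w) (φ w) γ) (n : ℕ) (w : X)
    (x : M) : ∃ (ι : Type) (_ : Fintype ι) (c : ι → ℝ) (a : ι → M), (∀ i, 0 ≤ c i) ∧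
      ∀ ψ, iterTransfer θ f φ n w ψ x = ∑ i, c i * ψ (a i) := by
  induction n generalizing w with
  | zero => exact ⟨Unit, inferInstance, fun _ => 1, fun _ => x, by simp, by simp [iterTransfer]⟩
  | succ n ih =>
    obtain ⟨ι, _, c, a, hc, h⟩ := ih (θ w)
    obtain ⟨N, -, henum⟩ := (hg w).exists_enum
    choose b hb using henum
    refine ⟨ι × Fin N, inferInstance, fun p => c p.1 * Real.exp (φ w (b (a p.1) p.2)),
      fun p => b (a p.1) p.2, fun p => mul_nonneg (hc _) (Real.exp_pos _).le, fun ψ => ?_⟩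
    rw [iterTransfer, h, Fintype.sum_prod_type]
    refine Finset.sum_congr rfl fun i _ => ?_
    rw [(hb (a i)).transfer_eq, Finset.mul_sum]
    exact Finset.sum_congr rfl fun j _ => by ring

theorem iterTransfer_mono (hg : ∀ w, MeanContracting (f w) (φ w) γ) (n : ℕ) (w : X)
    {ψ₁ ψ₂ : M → ℝ} (h : ∀ x, ψ₁ x ≤ ψ₂ x) (x : M) :
    iterTransfer θ f φ n w ψ₁ x ≤ iterTransfer θ f φ n w ψ₂ x := by
  obtain ⟨ι, _, c, a, hc, hsum⟩ := exists_iterTransfer_eq_sum (θ := θ) hg n w x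
  rw [hsum, hsum]
  exact Finset.sum_le_sum fun i _ => mul_le_mul_of_nonneg_left (h _) (hc i)

theorem abs_iterTransfer_le (hg : ∀ w, MeanContracting (f w) (φ w) γ) (n : ℕ) (w : X)
    {ψ₁ ψ₂ : M → ℝ} (h : ∀ x, |ψ₁ x| ≤ ψ₂ x) (x : M) :
    |iterTransfer θ f φ n w ψ₁ x| ≤ iterTransfer θ f φ n w ψ₂ x := by
  obtain ⟨ι, _, c, a, hc, hsum⟩ := exists_iterTransfer_eq_sum (θ := θ) hg n w x
  rw [hsum, hsum]
  refine (Finset.abs_sum_le_sum_abs _ _).trans (Finset.sum_le_sum fun i _ => ?_)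
  rw [abs_mul, abs_of_nonneg (hc i)]
  exact mul_le_mul_of_nonneg_left (h _) (hc i)

variable [CompactSpace M] [Nonempty M]

/-- The cone parameters follow an affine contraction, uniformly in the fibre. -/
theorem exists_affine_logCone (hg : ∀ w, MeanContracting (f w) (φ w) γ) (hγ : 0 ≤ γ)
    (hγ1 : γ < 1) {β : ℝ} (hβ : 0 < β) (hβ1 : β ≤ 1) {E : ℝ} (hE : 0 ≤ E)
    (hφ : ∀ w x y, φ w x - φ w y ≤ E * dist x y ^ β) :
    ∃ κ b : ℝ, 0 ≤ κ ∧ κ < 1 ∧ 0 ≤ b ∧ ∀ C : ℝ, 0 ≤ C → ∀ ψ : M → ℝ, LogCone β C ψ → ∀ w,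
      LogCone β (κ * C + b) (transfer (f w) (φ w) ψ) := by
  obtain ⟨D, hD, hdist⟩ : ∃ D : ℝ, 0 < D ∧ ∀ x y : M, dist x y ≤ D :=
    ⟨Metric.diam (univ : Set M) + 1, by positivity, fun x y =>
      (Metric.dist_le_diam_of_mem isCompact_univ.isBounded (mem_univ x) (mem_univ y)).trans
        (by linarith)⟩
  set k := γ ^ β with hk
  have hk0 : 0 ≤ k := Real.rpow_nonneg hγ _
  have hk1 : k < 1 := Real.rpow_lt_one hγ hγ1 hβ
  -- With `E a ≤ (1 - k) / 2` the slope `k (1 + E a)` stays below one.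
  set a := (1 - k) / (2 * (E + 1)) with ha
  have hap : 0 < a := div_pos (by linarith) (by linarith)
  have hEa : E * a ≤ (1 - k) / 2 := by
    rw [ha, ← mul_div_assoc, div_le_div_iff₀ (by linarith) (by norm_num)]
    nlinarith
  refine ⟨k * (E * a + 1), k * (E * Real.exp (β * D ^ β / a)), by positivity, ?_, by positivity,
    fun C hC ψ hψ w => ?_⟩
  · nlinarith
  · have := hψ.transfer (hg w) hβ hβ1 hC hγ hE (hφ w)
      (B := a * C + Real.exp (β * D ^ β / a)) (by positivity)
      (hψ.rpow_le hβ hC hD hdist hap)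
    convert this using 1
    ring

/-- The iterated transfer operators preserve the cone with parameters `β` and `C`, whose members
have oscillation at most `r`, and two members of it become proportional at rate `η n`, uniformly
in the fibre. -/
structure ContractsCone (θ : X → X) (f : X → M → M) (φ : X → M → ℝ) (β C r : ℝ) (η : ℕ → ℝ) :
    Prop where
  nonneg : 0 ≤ C
  one_le : 1 ≤ r
  tendsto : Tendsto η atTop (𝓝 0)
  logCone : ∀ ψ : M → ℝ, LogCone β C ψ → ∀ n w, LogCone β C (iterTransfer θ f φ n w ψ)
  le_mul : ∀ ψ : M → ℝ, LogCone β C ψ → ∀ x y, ψ x ≤ r * ψ y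
  abs_sub_le : ∀ (n : ℕ) (w : X) (ψ₁ ψ₂ : M → ℝ), LogCone β C ψ₁ → LogCone β C ψ₂ → ∀ x₀,
    iterTransfer θ f φ n w ψ₁ x₀ = iterTransfer θ f φ n w ψ₂ x₀ → ∀ x,
    |iterTransfer θ f φ n w ψ₁ x - iterTransfer θ f φ n w ψ₂ x| ≤
      η n * iterTransfer θ f φ n w ψ₁ x₀

/-- A coupling argument: a fraction `t` of the second function is split off from the first, the
remainder regains its regularity after `N` steps, and only the remainder contributes to the
difference. All constants come from the cone, so the rate does not depend on the fibre. The cone can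
be taken as large as desired, which lets any given cone function be treated. -/
theorem exists_contractsCone (θ : X → X) (hg : ∀ w, MeanContracting (f w) (φ w) γ) (hγ : 0 ≤ γ)
    (hγ1 : γ < 1) {β : ℝ} (hβ : 0 < β) (hβ1 : β ≤ 1) {E : ℝ} (hE : 0 ≤ E)
    (hφ : ∀ w x y, φ w x - φ w y ≤ E * dist x y ^ β) (C₀ : ℝ) :
    ∃ (C r : ℝ) (η : ℕ → ℝ), C₀ ≤ C ∧ ContractsCone θ f φ β C r η := by
  obtain ⟨κ, b, hκ0, hκ1, hb, haff⟩ := exists_affine_logCone hg hγ hγ1 hβ hβ1 hE hφ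
  have h1κ : 0 < 1 - κ := by linarith
  set c := b / (1 - κ) with hc
  have hc0 : 0 ≤ c := div_nonneg hb h1κ.le
  have hcfix : κ * c + b = c := by rw [hc]; field_simp; ring
  -- Here `c` is the fixed point of the affine map, and the excess `e` of the cone constant over it
  -- decays geometrically.
  have hit : ∀ (n : ℕ) (e : ℝ), 0 ≤ e → ∀ (w : X) (ψ : M → ℝ), LogCone β (e + c) ψ →
      LogCone β (κ ^ n * e + c) (iterTransfer θ f φ n w ψ) := by
    intro n
    induction n with
    | zero => intro e he w ψ h; simpa [iterTransfer] using h
    | succ n ih =>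
      intro e he w ψ h
      have h1 := haff _ (by positivity) ψ h w
      have h2 := ih (κ * e) (by positivity) (θ w) _
        (by convert h1 using 1; linear_combination -hcfix)
      rw [show κ ^ (n + 1) * e + c = κ ^ n * (κ * e) + c by ring]
      exact h2
  -- The margin `1` above the fixed point is what makes a larger cone enter this one in finite time.
  set C := max C₀ (1 + c) with hC
  have hC0 : C₀ ≤ C := le_max_left _ _
  have hC1 : 1 + c ≤ C := le_max_right _ _
  have hCn : 0 ≤ C := by linarith
  have hinv : ∀ ψ : M → ℝ, LogCone β C ψ → ∀ n w, LogCone β C (iterTransfer θ f φ n w ψ) := by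
    intro ψ hψ n w
    have := hit n (C - c) (by linarith) w ψ (by simpa using hψ)
    refine this.mono ?_
    have : κ ^ n * (C - c) ≤ 1 * (C - c) :=
      mul_le_mul_of_nonneg_right (pow_le_one₀ hκ0 hκ1.le) (by linarith)
    linarith
  obtain ⟨D, hD, hdist⟩ : ∃ D : ℝ, 0 < D ∧ ∀ x y : M, dist x y ≤ D :=
    ⟨Metric.diam (univ : Set M) + 1, by positivity, fun x y =>
      (Metric.dist_le_diam_of_mem isCompact_univ.isBounded (mem_univ x) (mem_univ y)).trans
        (by linarith)⟩
  set B := 1 * C + Real.exp (β * D ^ β / 1) with hB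
  have hB1 : 1 ≤ B := by
    have : 1 ≤ Real.exp (β * D ^ β / 1) := Real.one_le_exp (by positivity)
    linarith
  set r := B ^ (1 / β) with hr
  have hr1 : 1 ≤ r := Real.one_le_rpow hB1 (by positivity)
  have hratio : ∀ ψ : M → ℝ, LogCone β C ψ → ∀ x y, ψ x ≤ r * ψ y := by
    intro ψ hψ x y
    have h1 := hψ.rpow_le hβ hCn hD hdist one_pos x
    have h2 : ψ x ≤ r * ⨅ z, ψ z := by
      rw [← Real.rpow_le_rpow_iff (hψ.pos x).le (mul_nonneg (by linarith) hψ.iInf_pos.le) hβ,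
        Real.mul_rpow (by linarith) hψ.iInf_pos.le, hr, ← Real.rpow_mul (by linarith),
        one_div_mul_cancel hβ.ne', Real.rpow_one]
      exact h1
    exact h2.trans (mul_le_mul_of_nonneg_left (hψ.iInf_le y) (by linarith))
  -- If `ψ₂ ≤ ψ₁` at some point, two oscillation bounds give `ψ₂ ≤ r² inf ψ₁`, so `t ψ₂` is at most
  -- half of `inf ψ₁`.
  set t := 1 / (2 * r ^ 2) with ht
  have ht0 : 0 < t := by positivity
  have ht1 : t ≤ 1 / 2 := by
    rw [ht]
    refine one_div_le_one_div_of_le (by norm_num) ?_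
    nlinarith
  -- This is the constant of `logCone_of_holder` for `ψ₁ - t ψ₂`, with lower bound `m / 2`, upper
  -- bound `r m` and Hölder constant `C m (r + 1)`.
  set C' := 2 * C * (r + 1) * (2 * r) ^ β with hC'
  have hC'0 : 0 ≤ C' := by positivity
  have hsplit : ∀ ψ₁ ψ₂ : M → ℝ, LogCone β C ψ₁ → LogCone β C ψ₂ → (∃ p, ψ₂ p ≤ ψ₁ p) →
      LogCone β C' fun x => (1 - t)⁻¹ * (ψ₁ x + (-t) * ψ₂ x) := by
    rintro ψ₁ ψ₂ h₁ h₂ ⟨p, hp⟩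
    refine LogCone.const_mul ?_ (inv_pos.2 (by linarith))
    set m := ⨅ z, ψ₁ z with hm
    have hm0 : 0 < m := h₁.iInf_pos
    obtain ⟨z, hz, -⟩ := exists_eq_iInf_of_continuous h₁.continuous
    have hup : ∀ x, ψ₁ x ≤ r * m := fun x => by rw [hm, hz]; exact hratio _ h₁ x z
    have htψ : ∀ x, t * ψ₂ x ≤ m / 2 := fun x => by
      have : ψ₂ x ≤ r ^ 2 * m := by
        calc ψ₂ x ≤ r * ψ₂ p := hratio _ h₂ x p
          _ ≤ r * (r * m) := by gcongr; exact hp.trans (hup p)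
          _ = _ := by ring
      calc t * ψ₂ x ≤ t * (r ^ 2 * m) := by gcongr
        _ = m / 2 := by rw [ht]; field_simp
    have := logCone_of_holder hβ.le (χ := fun x => ψ₁ x + (-t) * ψ₂ x)
      (h₁.continuous.add (continuous_const.mul h₂.continuous)) (μ := m / 2) (S := r * m)
      (H := C * m * (r + 1)) (by linarith) (by positivity)
      (fun x => by linarith [htψ x, h₁.iInf_le x])
      (fun x => by linarith [hup x, mul_pos ht0 (h₂.pos x)])
      (fun x y => by
        have e1 := h₁.sub_le hβ.le hCn x y
        have e2 := h₂.sub_le hβ.le hCn y x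
        have hd : 0 ≤ dist x y ^ β := Real.rpow_nonneg dist_nonneg _
        rw [dist_comm] at e2
        have e3 : C * ψ₁ x * dist x y ^ β ≤ C * (r * m) * dist x y ^ β := by
          gcongr; exact hup x
        have e4 : t * (ψ₂ y - ψ₂ x) ≤ C * (m / 2) * dist x y ^ β := by
          calc t * (ψ₂ y - ψ₂ x) ≤ t * (C * ψ₂ y * dist x y ^ β) := by gcongr
            _ = C * (t * ψ₂ y) * dist x y ^ β := by ring
            _ ≤ _ := by gcongr; exact htψ y
        have e5 : 0 ≤ C * m * dist x y ^ β := by positivity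
        linarith)
    convert this using 1
    rw [hC', show r * m / (m / 2) = 2 * r by field_simp]
    field_simp
  obtain ⟨N₀, hN₀⟩ := exists_pow_lt_of_lt_one (show (0 : ℝ) < 1 / (C' + 1) by positivity) hκ1
  set N := N₀ + 1 with hN
  have hreg : ∀ w (ψ : M → ℝ), LogCone β C' ψ → LogCone β C (iterTransfer θ f φ N w ψ) := by
    intro w ψ hψ
    refine (hit N C' hC'0 w ψ (hψ.mono (by linarith))).mono ?_
    have h1 : κ ^ N ≤ 1 / (C' + 1) :=
      (pow_le_pow_of_le_one hκ0 hκ1.le (by omega)).trans hN₀.le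
    have h2 : κ ^ N * C' ≤ 1 := by
      rw [le_div_iff₀ (by positivity)] at h1
      nlinarith [pow_nonneg hκ0 N]
    linarith
  have hmain : ∀ (k n : ℕ) (w : X) (ψ₁ ψ₂ : M → ℝ), k * N ≤ n → LogCone β C ψ₁ →
      LogCone β C ψ₂ → ∀ x₀, iterTransfer θ f φ n w ψ₁ x₀ = iterTransfer θ f φ n w ψ₂ x₀ → ∀ x,
        |iterTransfer θ f φ n w ψ₁ x - iterTransfer θ f φ n w ψ₂ x| ≤
          (1 - t) ^ k * r * iterTransfer θ f φ n w ψ₁ x₀ := by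
    intro k
    induction k with
    | zero =>
      intro n w ψ₁ ψ₂ _ h₁ h₂ x₀ heq x
      have a1 := hinv _ h₁ n w
      have a2 := hinv _ h₂ n w
      have b1 := hratio _ a1 x x₀
      have b2 := hratio _ a2 x x₀
      have c1 := a1.pos x
      have c2 := a2.pos x
      rw [← heq] at b2
      rw [abs_le]
      constructor <;> linarith
    | succ k ih =>
      intro n w ψ₁ ψ₂ hn h₁ h₂ x₀ heq x
      obtain ⟨n', rfl⟩ : ∃ n', n = N + n' := ⟨n - N, by
        have : N ≤ n := le_trans (by nlinarith) hn
        omega⟩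
      -- The equality holds only at time `N + n'`; strict monotonicity of the operators carries it
      -- back to a comparison of the initial functions at some point.
      have hp : ∃ p, ψ₂ p ≤ ψ₁ p := by
        by_contra! hcon
        exact (iterTransfer_lt (θ := θ) hg (N + n') w hcon x₀).ne heq
      -- The remainder is rescaled so that `ψ₁ = (1 - t) χ + t ψ₂`; its final value at `x₀` then
      -- agrees with the other two, and the induction hypothesis applies.
      set χ : M → ℝ := fun x => (1 - t)⁻¹ * (ψ₁ x + (-t) * ψ₂ x) with hχ
      have hχit : ∀ y, iterTransfer θ f φ (N + n') w χ y = (1 - t)⁻¹ *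
          (iterTransfer θ f φ (N + n') w ψ₁ y + (-t) * iterTransfer θ f φ (N + n') w ψ₂ y) := by
        intro y
        rw [hχ, iterTransfer_const_mul hg, iterTransfer_fun_add hg, iterTransfer_const_mul hg]
      have h1t : 1 - t ≠ 0 := by linarith
      have hχ0 : iterTransfer θ f φ (N + n') w χ x₀ = iterTransfer θ f φ (N + n') w ψ₁ x₀ := by
        rw [hχit, ← heq]
        field_simp
        ring
      have hIH := ih n' (θ^[N] w) (iterTransfer θ f φ N w χ) (iterTransfer θ f φ N w ψ₂)
        (by nlinarith) (hreg w χ (hsplit _ _ h₁ h₂ hp)) (hinv _ h₂ N w) x₀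
        (by rw [← iterTransfer_add, ← iterTransfer_add, hχ0, heq]) x
      rw [← iterTransfer_add, ← iterTransfer_add, hχ0] at hIH
      have hdiff : iterTransfer θ f φ (N + n') w ψ₁ x - iterTransfer θ f φ (N + n') w ψ₂ x =
          (1 - t) * (iterTransfer θ f φ (N + n') w χ x - iterTransfer θ f φ (N + n') w ψ₂ x) := by
        rw [hχit]
        field_simp
        ring
      rw [hdiff, abs_mul, abs_of_pos (by linarith : 0 < 1 - t), pow_succ]
      calc (1 - t) * |iterTransfer θ f φ (N + n') w χ x - iterTransfer θ f φ (N + n') w ψ₂ x|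
          ≤ (1 - t) * ((1 - t) ^ k * r * iterTransfer θ f φ (N + n') w ψ₁ x₀) :=
            mul_le_mul_of_nonneg_left hIH (by linarith)
        _ = _ := by ring
  refine ⟨C, r, fun n => (1 - t) ^ (n / N) * r, hC0, hCn, hr1, ?_, hinv, hratio,
    fun n w ψ₁ ψ₂ h₁ h₂ x₀ heq x =>
      hmain (n / N) n w ψ₁ ψ₂ (Nat.div_mul_le_self n N) h₁ h₂ x₀ heq x⟩
  have h1 : Tendsto (fun n : ℕ => n / N) atTop atTop := Nat.tendsto_div_const_atTop (by omega)
  have h2 : Tendsto (fun k : ℕ => (1 - t) ^ k) atTop (𝓝 0) :=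
    tendsto_pow_atTop_nhds_zero_of_lt_one (by linarith) (by linarith)
  simpa using (h2.comp h1).mul_const r

end Iterates

/-! ### Convergence of normalized iterates and reference probabilities -/

section Conformal

variable {X M : Type*} [MetricSpace M] [CompactSpace M] [Nonempty M]
  {θ : X → X} {f : X → M → M} {φ : X → M → ℝ} {γ : ℝ}

theorem exists_dist_le (M : Type*) [MetricSpace M] [CompactSpace M] :
    ∃ D : ℝ, 1 ≤ D ∧ ∀ x y : M, dist x y ≤ D :=
  ⟨max (Metric.diam (univ : Set M)) 1, le_max_right _ _, fun x y =>
    (Metric.dist_le_diam_of_mem isCompact_univ.isBounded (mem_univ x) (mem_univ y)).trans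
      (le_max_left _ _)⟩

omit [CompactSpace M] [Nonempty M] in
theorem dist_rpow_le {D : ℝ} (hdist : ∀ x y : M, dist x y ≤ D) {β β' : ℝ} (hβ : 0 < β)
    (hβ' : β ≤ β') (x y : M) : dist x y ^ β' ≤ D ^ (β' - β) * dist x y ^ β := by
  rcases (dist_nonneg (x := x) (y := y)).eq_or_lt with h | h
  · rw [← h, Real.zero_rpow hβ.ne', Real.zero_rpow (by linarith), mul_zero]
  · calc dist x y ^ β' = dist x y ^ (β' - β) * dist x y ^ β := by
          rw [← Real.rpow_add h]; congr 1; ring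
      _ ≤ _ := by
          gcongr
          exact hdist x y

/-- Lipschitz functions determine weak convergence, so this makes the cones, modulo constants, a
sufficient class of test functions. The cone constant depends on the function. -/
theorem exists_logCone_add_const {β : ℝ} (hβ : 0 < β) (hβ1 : β ≤ 1) {g : M → ℝ} {L : ℝ≥0}
    (hg : LipschitzWith L g) : ∃ K C : ℝ, LogCone β C fun x => g x + K := by
  obtain ⟨D, hD1, hD⟩ := exists_dist_le M
  obtain ⟨z, -, hz⟩ := exists_eq_iInf_of_continuous hg.continuous
  obtain ⟨z', -, hz'⟩ := exists_eq_iInf_of_continuous hg.continuous.neg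
  refine ⟨1 - g z, _, logCone_of_holder hβ.le (χ := fun x => g x + (1 - g z))
    (hg.continuous.add continuous_const) one_pos
    (H := L * D ^ (1 - β)) (S := g z' + (1 - g z)) (by positivity)
    (fun x => by linarith [hz x]) (fun x => by linarith [neg_le_neg_iff.1 (hz' x)]) fun x y => ?_⟩
  have h1 := hg.dist_le_mul x y
  have h2 := dist_rpow_le hD hβ hβ1 x y
  rw [Real.rpow_one] at h2
  rw [Real.dist_eq] at h1
  calc g x + (1 - g z) - (g y + (1 - g z)) = g x - g y := by ring
    _ ≤ L * dist x y := (le_abs_self _).trans h1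
    _ ≤ L * (D ^ (1 - β) * dist x y ^ β) := by gcongr
    _ = _ := by ring

omit [CompactSpace M] in
/-- Quotients `L^n ψ / L^n 1` are almost constant. -/
theorem ContractsCone.abs_sub_quotient_le {β C r : ℝ} {η : ℕ → ℝ}
    (hc : ContractsCone θ f φ β C r η) (hg : ∀ w, MeanContracting (f w) (φ w) γ)
    {ψ : M → ℝ} (hψ : LogCone β C ψ) (n : ℕ) (w : X) (x₀ x : M) :
    |iterTransfer θ f φ n w ψ x - iterTransfer θ f φ n w ψ x₀ / iterTransfer θ f φ n w 1 x₀ *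
      iterTransfer θ f φ n w 1 x| ≤ |η n| * r * r * ψ x₀ * iterTransfer θ f φ n w 1 x := by
  have h1 : LogCone (M := M) β C 1 := LogCone.const hc.nonneg one_pos
  have hp1 : ∀ y, 0 < iterTransfer θ f φ n w 1 y := iterTransfer_pos hg n w h1.pos
  have hpψ : ∀ y, 0 < iterTransfer θ f φ n w ψ y := iterTransfer_pos hg n w hψ.pos
  set q := iterTransfer θ f φ n w ψ x₀ / iterTransfer θ f φ n w 1 x₀ with hq
  have hq0 : 0 < q := div_pos (hpψ _) (hp1 _)
  have hqL : q * iterTransfer θ f φ n w 1 x₀ = iterTransfer θ f φ n w ψ x₀ :=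
    div_mul_cancel₀ _ (hp1 _).ne'
  have hmul : iterTransfer θ f φ n w (fun _ => q) = fun y => q * iterTransfer θ f φ n w 1 y := by
    rw [← iterTransfer_const_mul hg]
    simp
  have h2 := hc.abs_sub_le n w ψ (fun _ => q) hψ (LogCone.const hc.nonneg hq0) x₀
    (by rw [hmul]; exact hqL.symm) x
  rw [hmul] at h2
  refine h2.trans ?_
  -- Comparing `ψ` with the constant `r ψ(x₀)` makes the error relative to `Lⁿ1`, with a factor
  -- uniform in the fibre.
  have h3 : iterTransfer θ f φ n w ψ x₀ ≤ r * ψ x₀ * iterTransfer θ f φ n w 1 x₀ := by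
    have h4 := iterTransfer_mono (θ := θ) hg n w (ψ₁ := ψ) (ψ₂ := fun y => (r * ψ x₀) * 1)
      (fun y => by simpa using hc.le_mul _ hψ y x₀) x₀
    rwa [iterTransfer_const_mul hg] at h4
  have h5 := hc.le_mul _ (hc.logCone 1 h1 n w) x₀ x
  have hr := hc.one_le
  have h6 := hψ.pos x₀
  calc η n * iterTransfer θ f φ n w ψ x₀ ≤ |η n| * (r * ψ x₀ * iterTransfer θ f φ n w 1 x₀) :=
        mul_le_mul (le_abs_self _) h3 (hpψ _).le (abs_nonneg _)
    _ ≤ |η n| * (r * ψ x₀ * (r * iterTransfer θ f φ n w 1 x)) := by gcongr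
    _ = _ := by ring

omit [CompactSpace M] in
theorem ContractsCone.cauchySeq_quotient {β C r : ℝ} {η : ℕ → ℝ}
    (hc : ContractsCone θ f φ β C r η) (hg : ∀ w, MeanContracting (f w) (φ w) γ)
    {ψ : M → ℝ} (hψ : LogCone β C ψ) (w : X) (x₀ : M) :
    CauchySeq fun n => iterTransfer θ f φ n w ψ x₀ / iterTransfer θ f φ n w 1 x₀ := by
  have hlim : Tendsto (fun n => |η n| * r * r * ψ x₀) atTop (𝓝 0) := by
    simpa using ((hc.tendsto.abs.mul_const r).mul_const r).mul_const (ψ x₀)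
  refine cauchySeq_of_le_tendsto_0 (fun n => 2 * (|η n| * r * r * ψ x₀)) ?_
    (by simpa using hlim.const_mul 2)
  have key : ∀ N n, N ≤ n → dist (iterTransfer θ f φ n w ψ x₀ / iterTransfer θ f φ n w 1 x₀)
      (iterTransfer θ f φ N w ψ x₀ / iterTransfer θ f φ N w 1 x₀) ≤
        |η N| * r * r * ψ x₀ := by
    intro N n hn
    obtain ⟨k, rfl⟩ := Nat.exists_eq_add_of_le hn
    have hp1 : 0 < iterTransfer θ f φ (N + k) w 1 x₀ :=
      iterTransfer_pos hg _ w (fun _ => one_pos) _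
    set q := iterTransfer θ f φ N w ψ x₀ / iterTransfer θ f φ N w 1 x₀ with hq
    -- The estimate at time `N` holds at all points, so applying the positive operator of the
    -- remaining `k` steps preserves it with the same constant.
    have h1 := abs_iterTransfer_le (θ := θ) hg k (θ^[N] w)
      (ψ₁ := fun x => iterTransfer θ f φ N w ψ x + (-q) * iterTransfer θ f φ N w 1 x)
      (ψ₂ := fun x => (|η N| * r * r * ψ x₀) * iterTransfer θ f φ N w 1 x)
      (fun x => by
        have := hc.abs_sub_quotient_le hg hψ N w x₀ x
        rwa [← hq, sub_eq_add_neg, ← neg_mul] at this) x₀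
    rw [iterTransfer_fun_add hg, iterTransfer_const_mul hg, iterTransfer_const_mul hg,
      ← iterTransfer_add, ← iterTransfer_add] at h1
    rw [Real.dist_eq, div_sub' hp1.ne', abs_div, abs_of_pos hp1, div_le_iff₀ hp1]
    rwa [mul_comm _ q, sub_eq_add_neg, ← neg_mul]
  intro n m N hn hm
  have h1 := key N n hn
  have h2 := key N m hm
  rw [dist_comm] at h2
  linarith [dist_triangle (iterTransfer θ f φ n w ψ x₀ / iterTransfer θ f φ n w 1 x₀)
    (iterTransfer θ f φ N w ψ x₀ / iterTransfer θ f φ N w 1 x₀)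
    (iterTransfer θ f φ m w ψ x₀ / iterTransfer θ f φ m w 1 x₀)]

variable [MeasurableSpace M] [BorelSpace M]

omit [Nonempty M] in
theorem exists_probabilityMeasure_iterTransfer (hg : ∀ w, MeanContracting (f w) (φ w) γ) (n : ℕ)
    (w : X) (x₀ : M) : ∃ ρ : ProbabilityMeasure M, ∀ ψ : M → ℝ,
      ∫ x, ψ x ∂(ρ : Measure M) =
        iterTransfer θ f φ n w ψ x₀ / iterTransfer θ f φ n w 1 x₀ := by
  obtain ⟨ι, _, c, a, hc, h⟩ := exists_iterTransfer_eq_sum (θ := θ) hg n w x₀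
  have hp : 0 < iterTransfer θ f φ n w 1 x₀ := iterTransfer_pos hg n w (fun _ => one_pos) x₀
  set s := iterTransfer θ f φ n w 1 x₀ with hs
  have hc' : ∀ i, 0 ≤ c i / s := fun i => div_nonneg (hc i) hp.le
  have hsum : ∑ i, c i / s = 1 := by
    rw [← Finset.sum_div, div_eq_one_iff_eq hp.ne', hs, h]
    simp
  refine ⟨⟨∑ i, ENNReal.ofReal (c i / s) • Measure.dirac (a i), ⟨?_⟩⟩, fun ψ => ?_⟩
  · simp only [Measure.coe_finsetSum, Finset.sum_apply, Measure.smul_apply, measure_univ,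
      smul_eq_mul, mul_one]
    rw [← ENNReal.ofReal_sum_of_nonneg fun i _ => hc' i, hsum, ENNReal.ofReal_one]
  · simp only [ProbabilityMeasure.coe_mk]
    rw [integral_finsetSum_measure fun i _ => (integrable_dirac (by simp)).smul_measure (by simp)]
    simp only [integral_smul_measure, integral_dirac, ENNReal.toReal_ofReal (hc' _), smul_eq_mul]
    rw [h, Finset.sum_div]
    exact Finset.sum_congr rfl fun i _ => by ring

/-- The reference probability of a fibre, as a limit of pulled back point masses. -/
theorem exists_probabilityMeasure_tendsto (hg : ∀ w, MeanContracting (f w) (φ w) γ) {β : ℝ}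
    (hβ : 0 < β) (hβ1 : β ≤ 1)
    (hcone : ∀ C₀ : ℝ, ∃ (C r : ℝ) (η : ℕ → ℝ), C₀ ≤ C ∧ ContractsCone θ f φ β C r η)
    (w : X) (x₀ : M) : ∃ ν : ProbabilityMeasure M, ∀ ψ : M → ℝ, Continuous ψ →
      Tendsto (fun n => iterTransfer θ f φ n w ψ x₀ / iterTransfer θ f φ n w 1 x₀) atTop
        (𝓝 (∫ x, ψ x ∂(ν : Measure M))) := by
  choose ρ hρ using fun n => exists_probabilityMeasure_iterTransfer (θ := θ) hg n w x₀
  -- Compactness supplies a limit along an ultrafilter. The Cauchy property on cone functions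
  -- promotes it to a limit of the whole sequence.
  obtain ⟨ν, -, hν⟩ := isCompact_iff_ultrafilter_le_nhds.1
    (isCompact_univ (X := ProbabilityMeasure M)) ((hyperfilter ℕ).map ρ) (by simp)
  have hν' : Tendsto ρ (hyperfilter ℕ : Filter ℕ) (𝓝 ν) := hν
  have hbcf : ∀ {l : Filter ℕ}, Tendsto ρ l (𝓝 ν) → ∀ ψ : M → ℝ, Continuous ψ →
      Tendsto (fun n => ∫ x, ψ x ∂(ρ n : Measure M)) l (𝓝 (∫ x, ψ x ∂(ν : Measure M))) := by
    intro l hl ψ hψ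
    have := ProbabilityMeasure.tendsto_iff_forall_integral_tendsto.1 hl
      (BoundedContinuousFunction.mkOfCompact ⟨ψ, hψ⟩)
    simpa using this
  have hfull : Tendsto ρ atTop (𝓝 ν) := by
    refine tendsto_iff_forall_lipschitz_integral_tendsto.2 fun g _ hL => ?_
    obtain ⟨L, hL⟩ := hL
    obtain ⟨K, C₀, hK⟩ := exists_logCone_add_const hβ hβ1 hL
    obtain ⟨C, r, η, hC, hc⟩ := hcone C₀
    obtain ⟨l, hl⟩ := cauchySeq_tendsto_of_complete
      (hc.cauchySeq_quotient hg (hK.mono hC) w x₀)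
    simp only [← hρ] at hl
    have hint : ∀ ρ : ProbabilityMeasure M,
        ∫ x, (g x + K) ∂(ρ : Measure M) = ∫ x, g x ∂(ρ : Measure M) + K := fun ρ => by
      rw [integral_add (hL.continuous.integrable_of_hasCompactSupport
        (HasCompactSupport.of_compactSpace _)) (integrable_const _)]
      simp
    simp only [hint] at hl
    have hl' : Tendsto (fun n => ∫ x, g x ∂(ρ n : Measure M)) atTop (𝓝 (l - K)) := by
      simpa using hl.sub_const K
    have := tendsto_nhds_unique (hl'.mono_left Nat.hyperfilter_le_atTop)
      (hbcf hν' g hL.continuous)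
    rwa [this] at hl'
  refine ⟨ν, fun ψ hψ => ?_⟩
  simp only [← hρ]
  exact hbcf hfull ψ hψ

/-- Probability measures agreeing on functions in the cones are equal. -/
theorem eq_of_forall_logCone {β : ℝ} (hβ : 0 < β) (hβ1 : β ≤ 1) {ρ ν : Measure M}
    [IsProbabilityMeasure ρ] [IsProbabilityMeasure ν]
    (h : ∀ (C : ℝ) (ψ : M → ℝ), LogCone β C ψ → ∫ x, ψ x ∂ρ = ∫ x, ψ x ∂ν) : ρ = ν := by
  let ρ' : ProbabilityMeasure M := ⟨ρ, inferInstance⟩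
  let ν' : ProbabilityMeasure M := ⟨ν, inferInstance⟩
  have : Tendsto (fun _ : ℕ => ρ') atTop (𝓝 ν') := by
    refine tendsto_iff_forall_lipschitz_integral_tendsto.2 fun g _ hL => ?_
    obtain ⟨L, hL⟩ := hL
    obtain ⟨K, C₀, hK⟩ := exists_logCone_add_const hβ hβ1 hL
    have h1 := h _ _ hK
    have hi : ∀ κ : Measure M, [IsProbabilityMeasure κ] → Integrable g κ := fun κ _ =>
      hL.continuous.integrable_of_hasCompactSupport (HasCompactSupport.of_compactSpace _)
    rw [integral_add (hi ρ) (integrable_const _), integral_add (hi ν) (integrable_const _)] at h1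
    simp only [integral_const, probReal_univ, one_smul, add_left_inj] at h1
    simp only [ρ', ν', ProbabilityMeasure.coe_mk, h1]
    exact tendsto_const_nhds
  have h2 : ρ' = ν' := tendsto_nhds_unique tendsto_const_nhds this
  exact congrArg (fun κ : ProbabilityMeasure M => (κ : Measure M)) h2

end Conformal

/-! ### Measurability of fibre sums and of the limit kernel -/

section Measurability

variable {X M : Type*} [MetricSpace M]

/-- It is a measurable event that the fibre over `x` meets a given ball. -/
theorem measurableSet_fiber_meets_ball [MeasurableSpace X] [CompactSpace M]
    [MeasurableSpace M] [BorelSpace M] {f : X → M → M} {d : ℕ → M} (hd : DenseRange d)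
    (hf : Measurable fun p : X × M => f p.1 p.2)
    (hfc : ∀ w, Continuous (f w)) (x c : M) (ρ : ℝ) :
    MeasurableSet {w | ∃ y ∈ Metric.ball c ρ, f w y = x} := by
  -- A preimage exists exactly when the dense sequence has approximate preimages of every accuracy
  -- in a slightly smaller ball; the gap `1 / (l + 1)` keeps their limit inside the open ball.
  have hset : {w | ∃ y ∈ Metric.ball c ρ, f w y = x} = ⋃ l : ℕ, ⋂ m : ℕ, ⋃ j : ℕ,
      {w | dist (d j) c < ρ - 1 / ((l : ℝ) + 1)} ∩
        {w | dist (f w (d j)) x < 1 / ((m : ℝ) + 1)} := by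
    ext w
    simp only [mem_ofPred_eq, mem_iUnion, mem_iInter, mem_inter_iff]
    constructor
    · rintro ⟨y, hy, rfl⟩
      obtain ⟨l, hl⟩ := exists_nat_one_div_lt (sub_pos.2 (Metric.mem_ball.1 hy))
      refine ⟨l, fun m => ?_⟩
      have hopen : IsOpen ({z | dist z c < ρ - 1 / ((l : ℝ) + 1)} ∩
          {z | dist (f w z) (f w y) < 1 / ((m : ℝ) + 1)}) :=
        (isOpen_lt (continuous_id.dist continuous_const) continuous_const).inter
          (isOpen_lt ((hfc w).dist continuous_const) continuous_const)
      obtain ⟨j, hj⟩ := hd.exists_mem_open hopen ⟨y, by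
        simp only [mem_inter_iff, mem_ofPred_eq, dist_self]
        exact ⟨by linarith, by positivity⟩⟩
      exact ⟨j, hj.1, hj.2⟩
    · rintro ⟨l, h⟩
      choose j hj1 hj2 using h
      obtain ⟨y, -, κ, hκ, hlim⟩ := isCompact_univ.tendsto_subseq
        (x := fun m => d (j m)) fun _ => mem_univ _
      refine ⟨y, ?_, ?_⟩
      · have h1 : dist y c ≤ ρ - 1 / ((l : ℝ) + 1) :=
          le_of_tendsto (hlim.dist tendsto_const_nhds) (Eventually.of_forall fun m => (hj1 _).le)
        have h2 : (0 : ℝ) < 1 / ((l : ℝ) + 1) := by positivity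
        exact Metric.mem_ball.2 (by linarith)
      · have h1 : Tendsto (fun m => dist (f w (d (j (κ m)))) x) atTop (𝓝 0) :=
          squeeze_zero (fun _ => dist_nonneg) (fun m => (hj2 (κ m)).le)
            (tendsto_one_div_add_atTop_nhds_zero_nat.comp hκ.tendsto_atTop)
        have h2 : Tendsto (fun m => dist (f w (d (j (κ m)))) x) atTop
            (𝓝 (dist (f w y) x)) :=
          (((hfc w).tendsto y).comp hlim).dist tendsto_const_nhds
        exact dist_eq_zero.1 (tendsto_nhds_unique h2 h1)
  rw [hset]
  refine MeasurableSet.iUnion fun l => MeasurableSet.iInter fun m => MeasurableSet.iUnion fun j =>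
    (MeasurableSet.const _).inter ?_
  exact measurableSet_lt ((hf.comp (measurable_id.prodMk measurable_const)).dist
    measurable_const) measurable_const

open Classical in
/-- The infimum of `F` over the ball of radius `1 / (k + 1)` about `d i` if this ball meets the
fibre of `g` over `x`, and zero otherwise. -/
noncomputable def fiberBallInf (d : ℕ → M) (g : M → M) (x : M) (F : M → ℝ) (k i : ℕ) : ℝ :=
  if ∃ y ∈ Metric.ball (d i) (1 / ((k : ℝ) + 1)), g y = x then
    ⨅ j : {j : ℕ // d j ∈ Metric.ball (d i) (1 / ((k : ℝ) + 1))}, F (d j) else 0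

theorem nonempty_ball_index (d : ℕ → M) (k i : ℕ) :
    Nonempty {j : ℕ // d j ∈ Metric.ball (d i) (1 / ((k : ℝ) + 1))} :=
  ⟨⟨i, Metric.mem_ball_self (by positivity)⟩⟩

theorem fiberBallInf_le {d : ℕ → M} (hd : DenseRange d) {g : M → M} {x : M} {F : M → ℝ}
    (hF : Continuous F) (hF0 : ∀ y, 0 ≤ F y) {k i : ℕ} {y : M}
    (hy : y ∈ Metric.ball (d i) (1 / ((k : ℝ) + 1))) : fiberBallInf d g x F k i ≤ F y := by
  unfold fiberBallInf
  split_ifs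
  · set c := ⨅ j : {j : ℕ // d j ∈ Metric.ball (d i) (1 / ((k : ℝ) + 1))}, F (d j) with hc
    have hclosed : IsClosed {z | c ≤ F z} := isClosed_le continuous_const hF
    have hsub : Metric.ball (d i) (1 / ((k : ℝ) + 1)) ∩ range d ⊆ {z | c ≤ F z} := by
      rintro _ ⟨hz, j, rfl⟩
      exact ciInf_le
        (f := fun j : {j : ℕ // d j ∈ Metric.ball (d i) (1 / ((k : ℝ) + 1))} => F (d j))
        ⟨0, by rintro _ ⟨j, rfl⟩; exact hF0 _⟩ ⟨j, hz⟩
    exact closure_minimal hsub hclosed (hd.open_subset_closure_inter Metric.isOpen_ball hy)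
  · exact hF0 y

theorem le_fiberBallInf {d : ℕ → M} {g : M → M} {F : M → ℝ} {k i : ℕ} {y : M}
    (hy : y ∈ Metric.ball (d i) (1 / ((k : ℝ) + 1))) {c : ℝ}
    (hc : ∀ z ∈ Metric.ball (d i) (1 / ((k : ℝ) + 1)), c ≤ F z) :
    c ≤ fiberBallInf d g (g y) F k i := by
  have := nonempty_ball_index d k i
  unfold fiberBallInf
  rw [if_pos ⟨y, hy, rfl⟩]
  exact le_ciInf fun j => hc _ j.2

/-- The sum of a nonnegative continuous function over a fibre, approximated through finite
disjoint families of balls. -/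
theorem isLUB_sum_fiber {d : ℕ → M} (hd : DenseRange d) {g : M → M} {x : M} {n : ℕ}
    {a : Fin n → M} (ha : IsFiberEnum g x a) {F : M → ℝ} (hF : Continuous F)
    (hF0 : ∀ y, 0 ≤ F y) :
    IsLUB {v : ℝ | ∃ p : {p : Finset ℕ × ℕ // (p.1 : Set ℕ).PairwiseDisjoint
        fun i => Metric.ball (d i) (1 / ((p.2 : ℝ) + 1))},
      ∑ i ∈ p.1.1, fiberBallInf d g x F p.1.2 i = v} (∑ i, F (a i)) := by
  classical
  have hpos : ∀ k : ℕ, (0 : ℝ) < 1 / ((k : ℝ) + 1) := fun k => by positivity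
  constructor
  · rintro _ ⟨⟨⟨s, k⟩, hdisj⟩, rfl⟩
    dsimp only at hdisj ⊢
    -- A ball contributes at most the value at one of its fibre points; disjointness then prevents
    -- counting a point twice.
    have h1 : ∀ i, fiberBallInf d g x F k i ≤
        ∑ l, if a l ∈ Metric.ball (d i) (1 / ((k : ℝ) + 1)) then F (a l) else 0 := by
      intro i
      by_cases hi : ∃ y ∈ Metric.ball (d i) (1 / ((k : ℝ) + 1)), g y = x
      · obtain ⟨y, hy, hyx⟩ := hi
        have : y ∈ range a := by rw [ha.2]; exact hyx
        obtain ⟨l, rfl⟩ := this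
        refine (fiberBallInf_le hd hF hF0 hy).trans ?_
        refine le_trans (by rw [if_pos hy]) (Finset.single_le_sum (f := fun l =>
          if a l ∈ Metric.ball (d i) (1 / ((k : ℝ) + 1)) then F (a l) else 0)
          (fun l _ => ?_) (Finset.mem_univ l))
        split_ifs
        · exact hF0 _
        · exact le_rfl
      · unfold fiberBallInf
        rw [if_neg hi]
        refine Finset.sum_nonneg fun l _ => ?_
        split_ifs
        · exact hF0 _
        · exact le_rfl
    refine (Finset.sum_le_sum fun i _ => h1 i).trans ?_
    rw [Finset.sum_comm]
    refine Finset.sum_le_sum fun l _ => ?_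
    by_cases hl : ∃ i ∈ s, a l ∈ Metric.ball (d i) (1 / ((k : ℝ) + 1))
    · obtain ⟨i, his, hi⟩ := hl
      rw [Finset.sum_eq_single_of_mem i his, if_pos hi]
      intro j hjs hji
      refine if_neg fun hj => ?_
      exact disjoint_left.1 (hdisj hjs his hji) hj hi
    · push Not at hl
      rw [Finset.sum_eq_zero fun i hi => if_neg (hl i hi)]
      exact hF0 _
  · intro B hB
    refine le_of_forall_pos_le_add fun ε hε => ?_
    set ε' := ε / (n + 1) with hε'
    have hε'0 : 0 < ε' := by positivity
    have hlim := tendsto_one_div_add_atTop_nhds_zero_nat (𝕜 := ℝ)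
    have hk1 : ∀ i, ∀ᶠ k : ℕ in atTop, ∀ z, dist z (a i) < 2 * (1 / ((k : ℝ) + 1)) →
        F (a i) - ε' ≤ F z := fun i => by
      obtain ⟨r, hr, hr'⟩ := Metric.continuous_iff.1 hF (a i) ε' hε'0
      filter_upwards [hlim.eventually_lt_const (half_pos hr)] with k hk z hz
      have := hr' z (by linarith)
      rw [Real.dist_eq, abs_lt] at this
      linarith
    have hk2 : ∀ i j, ∀ᶠ k : ℕ in atTop, i ≠ j → 4 * (1 / ((k : ℝ) + 1)) < dist (a i) (a j) :=
      fun i j => by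
        by_cases hij : i = j
        · exact Eventually.of_forall fun k h => (h hij).elim
        · have hp : 0 < dist (a i) (a j) / 4 := by
            have := dist_pos.2 (fun h => hij (ha.1 h))
            positivity
          filter_upwards [hlim.eventually_lt_const hp] with k hk _
          linarith
    -- The radius is so small that balls with centres near distinct fibre points are disjoint and
    -- `F` drops by at most `ε'` on each of them.
    obtain ⟨k, hk1, hk2⟩ := ((eventually_all.2 hk1).and
      (eventually_all.2 fun i => eventually_all.2 (hk2 i))).exists
    set ρ := 1 / ((k : ℝ) + 1) with hρ
    have hρ0 : 0 < ρ := hpos k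
    have hex : ∀ i, ∃ j, dist (a i) (d j) < ρ := fun i => by
      obtain ⟨j, hj⟩ := hd.exists_dist_lt (a i) hρ0
      exact ⟨j, hj⟩
    choose e he using hex
    have hdisj : ∀ i j, i ≠ j → Disjoint (Metric.ball (d (e i)) ρ) (Metric.ball (d (e j)) ρ) := by
      intro i j hij
      refine Metric.ball_disjoint_ball ?_
      have h1 := hk2 i j hij
      have h2 := he i
      have h3 := he j
      rw [dist_comm] at h3
      linarith [dist_triangle4 (a i) (d (e i)) (d (e j)) (a j)]
    have hinj : Function.Injective e := fun i j hij => by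
      by_contra hne
      have := hdisj i j hne
      rw [hij, disjoint_self, bot_eq_empty, Metric.ball_eq_empty] at this
      linarith
    have hmem : ∑ i ∈ Finset.univ.image e, fiberBallInf d g x F k i ≤ B := by
      refine hB ⟨⟨(Finset.univ.image e, k), ?_⟩, rfl⟩
      rintro i hi j hj hij
      obtain ⟨i, -, rfl⟩ := Finset.mem_image.1 hi
      obtain ⟨j, -, rfl⟩ := Finset.mem_image.1 hj
      exact hdisj i j fun h => hij (by rw [h])
    rw [Finset.sum_image fun i _ j _ h => hinj h] at hmem
    have hterm : ∀ i, F (a i) - ε' ≤ fiberBallInf d g x F k (e i) := fun i => by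
      rw [← ha.apply i]
      refine le_fiberBallInf (Metric.mem_ball.2 (he i)) fun z hz => hk1 i z ?_
      have h2 := he i
      rw [dist_comm] at h2
      have h3 := Metric.mem_ball.1 hz
      linarith [dist_triangle z (d (e i)) (a i)]
    have hsum := Finset.sum_le_sum fun i (_ : i ∈ Finset.univ) => hterm i
    rw [Finset.sum_sub_distrib] at hsum
    have hn : ∑ _i : Fin n, ε' ≤ ε := by
      rw [Finset.sum_const, Finset.card_univ, Fintype.card_fin, nsmul_eq_mul, hε',
        ← mul_div_assoc, div_le_iff₀ (by positivity)]
      nlinarith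
    linarith

variable [MeasurableSpace X] [CompactSpace M] [MeasurableSpace M] [BorelSpace M]
  {f : X → M → M} {φ : X → M → ℝ} {γ : ℝ}

/-- The transfer operators preserve joint measurability of fibrewise continuous functions. -/
theorem measurable_transfer [Nonempty M] (hg : ∀ w, MeanContracting (f w) (φ w) γ)
    (hf : Measurable fun p : X × M => f p.1 p.2) (hfc : ∀ w, Continuous (f w))
    (hφ : Measurable fun p : X × M => φ p.1 p.2) {Ψ : X → M → ℝ}
    (hΨ : Measurable fun p : X × M => Ψ p.1 p.2) (hΨc : ∀ w, Continuous (Ψ w))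
    (hΨ0 : ∀ w x, 0 ≤ Ψ w x) :
    Measurable fun p : X × M => transfer (f p.1) (φ p.1) (Ψ p.1) p.2 := by
  have hfix : ∀ x, Measurable fun w => transfer (f w) (φ w) (Ψ w) x := by
    intro x
    set d := TopologicalSpace.denseSeq M
    have hd : DenseRange d := TopologicalSpace.denseRange_denseSeq M
    set F : X → M → ℝ := fun w y => Real.exp (φ w y) * Ψ w y with hF
    have hFm : Measurable fun p : X × M => F p.1 p.2 := (Real.measurable_exp.comp hφ).mul hΨ
    refine Measurable.isLUB (ι := {p : Finset ℕ × ℕ // (p.1 : Set ℕ).PairwiseDisjoint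
        fun i => Metric.ball (d i) (1 / ((p.2 : ℝ) + 1))})
      (f := fun p w => ∑ i ∈ p.1.1, fiberBallInf d (f w) x (F w) p.1.2 i) ?_ ?_
    · intro p
      refine Finset.measurable_sum _ fun i _ => ?_
      unfold fiberBallInf
      refine Measurable.ite (measurableSet_fiber_meets_ball hd hf hfc x _ _) ?_ measurable_const
      have := nonempty_ball_index d p.1.2 i
      exact Measurable.iInf fun j => hFm.comp (measurable_id.prodMk measurable_const)
    · intro w
      obtain ⟨n, -, h⟩ := (hg w).exists_enum
      obtain ⟨a, ha⟩ := h x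
      have := isLUB_sum_fiber hd ha (F := F w)
        ((Real.continuous_exp.comp (hg w).continuous).mul (hΨc w))
        (fun y => mul_nonneg (Real.exp_pos _).le (hΨ0 w y))
      rw [ha.transfer_eq]
      exact this
  -- Measurability in `w` at fixed `x` and continuity in `x` at fixed `w` give joint measurability.
  have h := measurable_uncurry_of_continuous_of_measurable
    (u := fun x w => transfer (f w) (φ w) (Ψ w) x)
    (fun w => (hg w).continuous_transfer (hΨc w)) hfix
  exact h.comp measurable_swap

theorem measurable_iterTransfer [Nonempty M] (hg : ∀ w, MeanContracting (f w) (φ w) γ)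
    (hf : Measurable fun p : X × M => f p.1 p.2) (hfc : ∀ w, Continuous (f w))
    (hφ : Measurable fun p : X × M => φ p.1 p.2) {θ : X → X} (hθ : Measurable θ) {ψ : M → ℝ}
    (hψc : Continuous ψ) (hψ : ∀ x, 0 < ψ x) (n : ℕ) :
    Measurable fun p : X × M => iterTransfer θ f φ n p.1 ψ p.2 := by
  induction n with
  | zero => exact hψc.measurable.comp measurable_snd
  | succ n ih =>
    simp only [iterTransfer_succ]
    have hθn : Measurable fun p : X × M => θ^[n] p.1 := (hθ.iterate n).comp measurable_fst
    refine measurable_transfer (f := fun w => f (θ^[n] w)) (φ := fun w => φ (θ^[n] w))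
      (Ψ := fun w => iterTransfer θ f φ n w ψ) (fun w => hg _)
      (hf.comp (hθn.prodMk measurable_snd)) (fun w => hfc _)
      (hφ.comp (hθn.prodMk measurable_snd)) ih (fun w => continuous_iterTransfer hg n w hψc)
      (fun w x => (iterTransfer_pos hg n w hψ x).le)

omit [CompactSpace M] in
/-- A family of probabilities is a measurable kernel if the integrals of nonnegative continuous
functions are measurable. -/
theorem measurable_of_forall_integral {ν : X → ProbabilityMeasure M}
    (h : ∀ ψ : M → ℝ, Continuous ψ → (∀ x, 0 ≤ ψ x) →
      Measurable fun w => ∫ x, ψ x ∂(ν w : Measure M)) :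
    Measurable fun w => (ν w : Measure M) := by
  refine Measurable.measure_of_isPiSystem_of_isProbabilityMeasure (S := {s | IsClosed s})
    (by rw [← borel_eq_generateFrom_isClosed]; exact BorelSpace.measurable_eq)
    isPiSystem_isClosed fun s hs => ?_
  have hlim : ∀ w, Tendsto (fun n : ℕ => ENNReal.ofReal (∫ x, (thickenedIndicator
      (δ := 1 / ((n : ℝ) + 1)) (by positivity) s x : ℝ) ∂(ν w : Measure M))) atTop
      (𝓝 ((ν w : Measure M) s)) := fun w => by
    have := tendsto_integral_thickenedIndicator_of_isClosed (ν w : Measure M) hs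
      (δs := fun n => 1 / ((n : ℝ) + 1)) (fun n => by positivity)
      tendsto_one_div_add_atTop_nhds_zero_nat
    have h2 := ENNReal.tendsto_ofReal this
    rwa [Measure.real_def, ENNReal.ofReal_toReal (measure_ne_top _ _)] at h2
  exact measurable_of_tendsto_metrizable (fun n => ENNReal.measurable_ofReal.comp
    (h _ (by fun_prop) fun x => NNReal.coe_nonneg _)) (tendsto_pi_nhds.2 hlim)

end Measurability

theorem integrable_of_continuous {M : Type*} [TopologicalSpace M] [CompactSpace M]
    [MeasurableSpace M] [OpensMeasurableSpace M] [T2Space M] {ψ : M → ℝ} (hψ : Continuous ψ)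
    (ρ : Measure M) [IsFiniteMeasure ρ] : Integrable ψ ρ :=
  hψ.integrable_of_hasCompactSupport (HasCompactSupport.of_compactSpace _)

/-! ### The reference kernel and iterated duality -/

section Reference

variable {X M : Type*} [MeasurableSpace X] [MetricSpace M] [CompactSpace M] [Nonempty M]
  [MeasurableSpace M] [BorelSpace M] {θ : X → X} {f : X → M → M} {φ : X → M → ℝ} {γ : ℝ}

/-- The duality passes to the limit from the identity that factors the quotient of `Lψ` at `θ w`
into the quotient of `L1` at `θ w` and the quotient of `ψ` at `w`, one step later. -/
theorem exists_conformal_kernel (hg : ∀ w, MeanContracting (f w) (φ w) γ)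
    (hf : Measurable fun p : X × M => f p.1 p.2) (hfc : ∀ w, Continuous (f w))
    (hφ : Measurable fun p : X × M => φ p.1 p.2) (hθ : Measurable θ) {β : ℝ}
    (hβ : 0 < β) (hβ1 : β ≤ 1)
    (hcone : ∀ C₀ : ℝ, ∃ (C r : ℝ) (η : ℕ → ℝ), C₀ ≤ C ∧ ContractsCone θ f φ β C r η) :
    ∃ ν : Kernel X M, IsMarkovKernel ν ∧ ∀ w (ψ : M → ℝ), Continuous ψ →
      ∫ x, transfer (f w) (φ w) ψ x ∂(ν (θ w)) = eigenvalue θ f φ ν w * ∫ x, ψ x ∂(ν w) := by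
  obtain ⟨x₀⟩ : Nonempty M := inferInstance
  choose ν₀ hν₀ using fun w => exists_probabilityMeasure_tendsto hg hβ hβ1 hcone w x₀
  have hmeas : Measurable fun w => (ν₀ w : Measure M) := by
    refine measurable_of_forall_integral fun ψ hψ hψ0 => ?_
    -- The shift by `1` makes the function strictly positive, as measurability of the iterates
    -- requires.
    have h1 : Measurable fun w => ∫ x, (ψ x + 1) ∂(ν₀ w : Measure M) := by
      refine measurable_of_tendsto_metrizable (fun n => ?_)
        (tendsto_pi_nhds.2 fun w => hν₀ w _ (hψ.add continuous_const))
      have hm : ∀ χ : M → ℝ, Continuous χ → (∀ x, 0 < χ x) →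
          Measurable fun w => iterTransfer θ f φ n w χ x₀ := fun χ hχ hχ0 =>
        (measurable_iterTransfer hg hf hfc hφ hθ hχ hχ0 n).comp
          (measurable_id.prodMk measurable_const)
      exact (hm (fun x => ψ x + 1) (hψ.add continuous_const) fun x => by linarith [hψ0 x]).div
        (hm 1 continuous_const fun _ => one_pos)
    have h2 : ∀ w, ∫ x, ψ x ∂(ν₀ w : Measure M) = ∫ x, (ψ x + 1) ∂(ν₀ w : Measure M) - 1 :=
      fun w => by
        rw [integral_add (integrable_of_continuous hψ _) (integrable_const _)]
        simp
    simp only [h2]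
    exact h1.sub_const 1
  refine ⟨⟨fun w => (ν₀ w : Measure M), hmeas⟩, ⟨fun w => by
    change IsProbabilityMeasure (ν₀ w : Measure M); infer_instance⟩, fun w ψ hψ => ?_⟩
  have h1 := hν₀ (θ w) _ ((hg w).continuous_transfer hψ)
  have h2 := (hν₀ (θ w) _ ((hg w).continuous_transfer (ψ := fun _ => 1) continuous_const)).mul
    ((hν₀ w ψ hψ).comp (tendsto_add_atTop_nat 1))
  refine tendsto_nhds_unique h1 (h2.congr fun n => ?_)
  have hp1 : iterTransfer θ f φ n (θ w) (transfer (f w) (φ w) 1) x₀ ≠ 0 :=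
    (iterTransfer_pos hg n _ ((hg w).transfer_pos fun _ => one_pos) x₀).ne'
  simp only [Function.comp_apply, iterTransfer]
  rw [mul_comm]
  exact div_mul_div_cancel₀ hp1

omit [Nonempty M] [BorelSpace M] in
/-- Iteration of the duality relation along an orbit. -/
theorem integral_iterTransfer {ν : Kernel X M} (hg : ∀ w, MeanContracting (f w) (φ w) γ) (n : ℕ)
    {w : X} (h : ∀ k, ∀ ψ : M → ℝ, Continuous ψ →
      ∫ x, transfer (f (θ^[k] w)) (φ (θ^[k] w)) ψ x ∂(ν (θ (θ^[k] w))) =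
        eigenvalue θ f φ ν (θ^[k] w) * ∫ x, ψ x ∂(ν (θ^[k] w))) {ψ : M → ℝ} (hψ : Continuous ψ) :
    ∫ x, iterTransfer θ f φ n w ψ x ∂(ν (θ^[n] w)) =
      (∏ k ∈ Finset.range n, eigenvalue θ f φ ν (θ^[k] w)) * ∫ x, ψ x ∂(ν w) := by
  induction n generalizing w ψ with
  | zero => simp [iterTransfer]
  | succ n ih =>
    have h1 := ih (w := θ w) (fun k => h (k + 1)) ((hg w).continuous_transfer hψ)
    have h0 := h 0 ψ hψ
    simp only [Function.iterate_zero, id_eq] at h0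
    simp only [iterTransfer, Function.iterate_succ, Function.comp_apply]
    rw [h1, h0, Finset.prod_range_succ']
    simp only [Function.iterate_succ, Function.comp_apply, Function.iterate_zero, id_eq]
    ring

theorem eigenvalue_pos (hg : ∀ w, MeanContracting (f w) (φ w) γ) (ν : Kernel X M)
    [IsMarkovKernel ν] (w : X) : 0 < eigenvalue θ f φ ν w := by
  have hc := (hg w).continuous_transfer (ψ := fun _ => 1) continuous_const
  obtain ⟨z, -, hz⟩ := exists_eq_iInf_of_continuous hc
  have h1 : ∫ _x, transfer (f w) (φ w) (fun _ => 1) z ∂(ν (θ w)) ≤ eigenvalue θ f φ ν w :=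
    integral_mono (integrable_const _) (integrable_of_continuous hc _) hz
  simp only [integral_const, probReal_univ, one_smul] at h1
  exact ((hg w).transfer_pos (fun _ => one_pos) z).trans_le h1

theorem prod_eigenvalue_pos (hg : ∀ w, MeanContracting (f w) (φ w) γ) (ν : Kernel X M)
    [IsMarkovKernel ν] (n : ℕ) (w : X) :
    0 < ∏ k ∈ Finset.range n, eigenvalue θ f φ ν (θ^[k] w) :=
  Finset.prod_pos fun _ _ => eigenvalue_pos hg ν _

/-- Families satisfying the duality relation along an orbit are limits of quotients. -/
theorem ContractsCone.tendsto_integral {β C r : ℝ} {η : ℕ → ℝ}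
    (hc : ContractsCone θ f φ β C r η) (hg : ∀ w, MeanContracting (f w) (φ w) γ)
    {ν : Kernel X M} [IsMarkovKernel ν] {w : X} (h : ∀ k, ∀ ψ : M → ℝ, Continuous ψ →
      ∫ x, transfer (f (θ^[k] w)) (φ (θ^[k] w)) ψ x ∂(ν (θ (θ^[k] w))) =
        eigenvalue θ f φ ν (θ^[k] w) * ∫ x, ψ x ∂(ν (θ^[k] w)))
    {ψ : M → ℝ} (hψ : LogCone β C ψ) (x₀ : M) :
    Tendsto (fun n => iterTransfer θ f φ n w ψ x₀ / iterTransfer θ f φ n w 1 x₀) atTop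
      (𝓝 (∫ x, ψ x ∂(ν w))) := by
  have hlim : Tendsto (fun n => |η n| * r * r * ψ x₀) atTop (𝓝 0) := by
    simpa using ((hc.tendsto.abs.mul_const r).mul_const r).mul_const (ψ x₀)
  refine tendsto_iff_dist_tendsto_zero.2 (squeeze_zero (fun _ => dist_nonneg) (fun n => ?_) hlim)
  set q := iterTransfer θ f φ n w ψ x₀ / iterTransfer θ f φ n w 1 x₀ with hq
  have h1 := integral_iterTransfer hg n h hψ.continuous
  have h2 := integral_iterTransfer hg n h (ψ := 1) continuous_const
  have hΛ := prod_eigenvalue_pos (θ := θ) hg ν n w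
  set Λ := ∏ k ∈ Finset.range n, eigenvalue θ f φ ν (θ^[k] w)
  simp only [Pi.one_apply, integral_const, probReal_univ, one_smul, mul_one] at h2
  have hc1 := continuous_iterTransfer (θ := θ) hg n w hψ.continuous
  have hc2 := continuous_iterTransfer (θ := θ) (ψ := 1) hg n w continuous_const
  -- Integrating the pointwise estimate against `ν (θ^[n] w)` produces the common factor `Λ`, which
  -- cancels and leaves the distance of the quotient to the integral of `ψ`.
  have h3 : |∫ x, (iterTransfer θ f φ n w ψ x - q * iterTransfer θ f φ n w 1 x) ∂(ν (θ^[n] w))| ≤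
      ∫ x, (|η n| * r * r * ψ x₀) * iterTransfer θ f φ n w 1 x ∂(ν (θ^[n] w)) := by
    refine (abs_integral_le_integral_abs).trans (integral_mono ?_ ?_ fun x => ?_)
    · exact (integrable_of_continuous (hc1.sub (continuous_const.mul hc2)) _).abs
    · exact integrable_of_continuous (continuous_const.mul hc2) _
    · exact hc.abs_sub_quotient_le hg hψ n w x₀ x
  rw [integral_sub (integrable_of_continuous hc1 _)
    ((integrable_of_continuous hc2 _).const_mul q), integral_const_mul,
    integral_const_mul, h1, h2, mul_comm q, ← mul_sub, abs_mul, abs_of_pos hΛ, mul_comm] at h3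
  rw [dist_comm, Real.dist_eq]
  exact le_of_mul_le_mul_right h3 hΛ

/-- Two functions of the cone with the same integral become equal under normalized iteration. -/
theorem ContractsCone.abs_sub_le_of_integral_eq [PreconnectedSpace M] {β C r : ℝ} {η : ℕ → ℝ}
    (hc : ContractsCone θ f φ β C r η) (hg : ∀ w, MeanContracting (f w) (φ w) γ)
    {ν : Kernel X M} [IsMarkovKernel ν] {w : X} (h : ∀ k, ∀ ψ : M → ℝ, Continuous ψ →
      ∫ x, transfer (f (θ^[k] w)) (φ (θ^[k] w)) ψ x ∂(ν (θ (θ^[k] w))) =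
        eigenvalue θ f φ ν (θ^[k] w) * ∫ x, ψ x ∂(ν (θ^[k] w)))
    {ψ₁ ψ₂ : M → ℝ} (h₁ : LogCone β C ψ₁) (h₂ : LogCone β C ψ₂) (hi₁ : ∫ x, ψ₁ x ∂(ν w) = 1)
    (hi₂ : ∫ x, ψ₂ x ∂(ν w) = 1) (n : ℕ) (x : M) :
    |iterTransfer θ f φ n w ψ₁ x - iterTransfer θ f φ n w ψ₂ x| ≤
      |η n| * r * ∏ k ∈ Finset.range n, eigenvalue θ f φ ν (θ^[k] w) := by
  have e1 := integral_iterTransfer hg n h h₁.continuous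
  have e2 := integral_iterTransfer hg n h h₂.continuous
  have hΛ := prod_eigenvalue_pos (θ := θ) hg ν n w
  set Λ := ∏ k ∈ Finset.range n, eigenvalue θ f φ ν (θ^[k] w)
  have hc1 := continuous_iterTransfer (θ := θ) hg n w h₁.continuous
  have hc2 := continuous_iterTransfer (θ := θ) hg n w h₂.continuous
  have hd0 : ∫ x, (iterTransfer θ f φ n w ψ₁ x - iterTransfer θ f φ n w ψ₂ x)
      ∂(ν (θ^[n] w)) = 0 := by
    rw [integral_sub (integrable_of_continuous hc1 _) (integrable_of_continuous hc2 _), e1, e2,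
      hi₁, hi₂, sub_self]
  have hint : Integrable (fun x => iterTransfer θ f φ n w ψ₁ x - iterTransfer θ f φ n w ψ₂ x)
      (ν (θ^[n] w)) := integrable_of_continuous (hc1.sub hc2) _
  -- The difference of the iterates has integral zero, so by connectedness it vanishes somewhere;
  -- this is the point that the cone contraction needs.
  obtain ⟨y, hy⟩ := exists_le_integral hint
  obtain ⟨z, hz⟩ := exists_integral_le hint
  rw [hd0] at hy hz
  obtain ⟨x₀, hx₀⟩ := mem_range_of_exists_le_of_exists_ge (hc1.sub hc2) ⟨y, hy⟩ ⟨z, hz⟩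
  have h3 := hc.abs_sub_le n w ψ₁ ψ₂ h₁ h₂ x₀ (sub_eq_zero.1 hx₀) x
  have h4 : iterTransfer θ f φ n w ψ₁ x₀ ≤ r * Λ := by
    have := integral_mono (μ := ν (θ^[n] w)) (integrable_const (iterTransfer θ f φ n w ψ₁ x₀))
      ((integrable_of_continuous hc1 _).const_mul r)
      (fun y => hc.le_mul _ (hc.logCone _ h₁ n w) x₀ y)
    rw [integral_const_mul, e1, hi₁] at this
    simpa using this
  calc _ ≤ η n * iterTransfer θ f φ n w ψ₁ x₀ := h3
    _ ≤ |η n| * (r * Λ) := mul_le_mul (le_abs_self _) h4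
        (iterTransfer_pos hg n w h₁.pos x₀).le (abs_nonneg _)
    _ = _ := by ring

end Reference

/-! ### Invariant densities as limits from the past -/

section Density

variable {X M : Type*} [MeasurableSpace X] [MetricSpace M] [CompactSpace M] [Nonempty M]
  [MeasurableSpace M] [BorelSpace M] {θ : X ≃ᵐ X} {f : X → M → M} {φ : X → M → ℝ} {γ : ℝ}

/-- The functions `L^n 1` arriving in the fibre of `w`, normalized by the eigenvalues. -/
noncomputable def normalizedIter (θ : X ≃ᵐ X) (f : X → M → M) (φ : X → M → ℝ) (ν : Kernel X M)
    (n : ℕ) (w : X) (x : M) : ℝ :=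
  (∏ k ∈ Finset.range n, eigenvalue θ f φ ν (θ^[k] (θ.symm^[n] w)))⁻¹ *
    iterTransfer θ f φ n (θ.symm^[n] w) 1 x

theorem iterate_symm_iterate (θ : X ≃ᵐ X) (n : ℕ) (w : X) : θ^[n] (θ.symm^[n] w) = w :=
  Function.RightInverse.iterate θ.apply_symm_apply n w

theorem measurable_eigenvalue {θ : X → X} (hg : ∀ w, MeanContracting (f w) (φ w) γ)
    (hf : Measurable fun p : X × M => f p.1 p.2) (hfc : ∀ w, Continuous (f w))
    (hφ : Measurable fun p : X × M => φ p.1 p.2) (hθ : Measurable θ) (ν : Kernel X M)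
    [IsMarkovKernel ν] : Measurable (eigenvalue θ f φ ν) := by
  have h1 := measurable_transfer hg hf hfc hφ (Ψ := fun _ _ => 1) measurable_const
    (fun _ => continuous_const) fun _ _ => zero_le_one
  have h2 := StronglyMeasurable.integral_kernel_prod_right (κ := ν.comap θ hθ)
    (f := fun w x => transfer (f w) (φ w) (fun _ => 1) x) h1.stronglyMeasurable
  exact h2.measurable

theorem measurable_normalizedIter (hg : ∀ w, MeanContracting (f w) (φ w) γ)
    (hf : Measurable fun p : X × M => f p.1 p.2) (hfc : ∀ w, Continuous (f w))
    (hφ : Measurable fun p : X × M => φ p.1 p.2) (ν : Kernel X M) [IsMarkovKernel ν] (n : ℕ) :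
    Measurable fun p : X × M => normalizedIter θ f φ ν n p.1 p.2 := by
  have hs : Measurable fun p : X × M => θ.symm^[n] p.1 :=
    (θ.symm.measurable.iterate n).comp measurable_fst
  refine Measurable.mul (Measurable.inv (Finset.measurable_prod _ fun k _ => ?_)) ?_
  · exact (measurable_eigenvalue hg hf hfc hφ θ.measurable ν).comp
      ((θ.measurable.iterate k).comp hs)
  · exact (measurable_iterTransfer hg hf hfc hφ θ.measurable continuous_const
      (fun _ => one_pos) n).comp (hs.prodMk measurable_snd)

omit [CompactSpace M] [Nonempty M] [BorelSpace M] in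
theorem normalizedIter_add (hg : ∀ w, MeanContracting (f w) (φ w) γ) (ν : Kernel X M)
    (k n : ℕ) (w : X) (x : M) : normalizedIter θ f φ ν (k + n) w x =
      (∏ j ∈ Finset.range n, eigenvalue θ f φ ν (θ^[j] (θ.symm^[n] w)))⁻¹ *
        iterTransfer θ f φ n (θ.symm^[n] w) (normalizedIter θ f φ ν k (θ.symm^[n] w)) x := by
  unfold normalizedIter
  rw [iterTransfer_const_mul hg, iterTransfer_add, Function.iterate_add_apply θ.symm,
    iterate_symm_iterate, Finset.prod_range_add, mul_inv]
  have : ∀ j, θ^[k + j] (θ.symm^[k] (θ.symm^[n] w)) = θ^[j] (θ.symm^[n] w) := fun j => by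
    rw [add_comm, Function.iterate_add_apply, iterate_symm_iterate]
  simp only [this]
  ring

theorem transfer_normalizedIter (hg : ∀ w, MeanContracting (f w) (φ w) γ) (ν : Kernel X M)
    [IsMarkovKernel ν] (n : ℕ) (w : X) (x : M) :
    transfer (f w) (φ w) (normalizedIter θ f φ ν n w) x =
      eigenvalue θ f φ ν w * normalizedIter θ f φ ν (n + 1) (θ w) x := by
  unfold normalizedIter
  rw [(hg w).transfer_const_mul, Function.iterate_succ_apply, θ.symm_apply_apply,
    iterTransfer_succ, Finset.prod_range_succ, iterate_symm_iterate, mul_inv]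
  have := (eigenvalue_pos (θ := θ) hg ν w).ne'
  field_simp

variable {ν : Kernel X M} [IsMarkovKernel ν] {β C r : ℝ} {η : ℕ → ℝ}

theorem ContractsCone.logCone_normalizedIter (hc : ContractsCone θ f φ β C r η)
    (hg : ∀ w, MeanContracting (f w) (φ w) γ) (n : ℕ) (w : X) :
    LogCone β C (normalizedIter θ f φ ν n w) :=
  (hc.logCone _ (LogCone.const hc.nonneg one_pos) n _).const_mul
    (inv_pos.2 (prod_eigenvalue_pos hg ν n _))

theorem integral_normalizedIter (hg : ∀ w, MeanContracting (f w) (φ w) γ)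
    (hν : ∀ w (ψ : M → ℝ), Continuous ψ →
      ∫ x, transfer (f w) (φ w) ψ x ∂(ν (θ w)) = eigenvalue θ f φ ν w * ∫ x, ψ x ∂(ν w))
    (n : ℕ) (w : X) : ∫ x, normalizedIter θ f φ ν n w x ∂(ν w) = 1 := by
  have h := integral_iterTransfer (θ := θ) (w := θ.symm^[n] w) hg n (fun k => hν _) (ψ := 1)
    continuous_const
  rw [iterate_symm_iterate] at h
  unfold normalizedIter
  rw [integral_const_mul, h]
  simp only [Pi.one_apply, integral_const, probReal_univ, one_smul, mul_one]
  exact inv_mul_cancel₀ (prod_eigenvalue_pos hg ν n _).ne'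

theorem ContractsCone.abs_normalizedIter_sub_le [PreconnectedSpace M]
    (hc : ContractsCone θ f φ β C r η) (hg : ∀ w, MeanContracting (f w) (φ w) γ)
    (hν : ∀ w (ψ : M → ℝ), Continuous ψ →
      ∫ x, transfer (f w) (φ w) ψ x ∂(ν (θ w)) = eigenvalue θ f φ ν w * ∫ x, ψ x ∂(ν w))
    (n : ℕ) (w : X) {ψ : M → ℝ} (hψ : LogCone β C ψ) (hi : ∫ x, ψ x ∂(ν (θ.symm^[n] w)) = 1)
    (x : M) :
    |(∏ j ∈ Finset.range n, eigenvalue θ f φ ν (θ^[j] (θ.symm^[n] w)))⁻¹ *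
        iterTransfer θ f φ n (θ.symm^[n] w) ψ x - normalizedIter θ f φ ν n w x| ≤ |η n| * r := by
  have hΛ := prod_eigenvalue_pos (θ := θ) hg ν n (θ.symm^[n] w)
  have h := hc.abs_sub_le_of_integral_eq hg (w := θ.symm^[n] w) (fun k => hν _) hψ
    (LogCone.const (c := 1) hc.nonneg one_pos) hi (by simp) n x
  unfold normalizedIter
  rw [← mul_sub, abs_mul, abs_of_pos (inv_pos.2 hΛ), inv_mul_le_iff₀ hΛ, mul_comm _ (|η n| * r)]
  exact h

/-- Existence of the densities. -/
theorem ContractsCone.exists_density [PreconnectedSpace M] (hc : ContractsCone θ f φ β C r η)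
    (hβ : 0 < β) (hg : ∀ w, MeanContracting (f w) (φ w) γ)
    (hf : Measurable fun p : X × M => f p.1 p.2) (hfc : ∀ w, Continuous (f w))
    (hφ : Measurable fun p : X × M => φ p.1 p.2)
    (hν : ∀ w (ψ : M → ℝ), Continuous ψ →
      ∫ x, transfer (f w) (φ w) ψ x ∂(ν (θ w)) = eigenvalue θ f φ ν w * ∫ x, ψ x ∂(ν w)) :
    ∃ h : X → M → ℝ, Measurable (fun p : X × M => h p.1 p.2) ∧
      (∀ w x, Tendsto (fun n => normalizedIter θ f φ ν n w x) atTop (𝓝 (h w x))) ∧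
      (∀ w x y, h w x - h w y ≤ C * r * dist x y ^ β) ∧
      (∀ w x, r⁻¹ ≤ h w x ∧ h w x ≤ r) ∧
      (∀ w x, transfer (f w) (φ w) (h w) x = eigenvalue θ f φ ν w * h (θ w) x) ∧
      ∀ w, ∫ x, h w x ∂(ν w) = 1 := by
  have hr : 0 < r := one_pos.trans_le hc.one_le
  have hηr : Tendsto (fun n => |η n| * r) atTop (𝓝 0) := by
    simpa using hc.tendsto.abs.mul_const r
  have hcone := fun n w => hc.logCone_normalizedIter (ν := ν) hg n w
  -- Both functions are `n` normalized steps from the fibre of `θ⁻ⁿ w`: one starts from an earlier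
  -- normalized iterate, the other from `1`, and both starting functions lie in the cone with
  -- integral one.
  have hcl : ∀ w x n k, |normalizedIter θ f φ ν (k + n) w x - normalizedIter θ f φ ν n w x| ≤
      |η n| * r := fun w x n k => by
    rw [normalizedIter_add hg]
    exact hc.abs_normalizedIter_sub_le hg hν n w (hcone k _) (integral_normalizedIter hg hν k _) x
  have hcauchy : ∀ w x, CauchySeq fun n => normalizedIter θ f φ ν n w x := fun w x => by
    refine cauchySeq_of_le_tendsto_0 (fun n => 2 * (|η n| * r)) (fun n m N hn hm => ?_)
      (by simpa using hηr.const_mul 2)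
    obtain ⟨k, rfl⟩ := Nat.exists_eq_add_of_le' hn
    obtain ⟨l, rfl⟩ := Nat.exists_eq_add_of_le' hm
    rw [Real.dist_eq]
    have h1 := abs_le.1 (hcl w x N k)
    have h2 := abs_le.1 (hcl w x N l)
    rw [abs_le]
    constructor <;> linarith [h1.1, h1.2, h2.1, h2.2]
  choose h hh using fun w x => cauchySeq_tendsto_of_complete (hcauchy w x)
  -- Integral one and oscillation at most `r` force the values into `[r⁻¹, r]`.
  have hup : ∀ n w x, normalizedIter θ f φ ν n w x ≤ r := fun n w x => by
    have := integral_mono (μ := ν w) (integrable_const (normalizedIter θ f φ ν n w x))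
      ((integrable_of_continuous (hcone n w).continuous _).const_mul r)
      (fun y => hc.le_mul _ (hcone n w) x y)
    rw [integral_const_mul, integral_normalizedIter hg hν] at this
    simpa using this
  have hlow : ∀ n w x, r⁻¹ ≤ normalizedIter θ f φ ν n w x := fun n w x => by
    have := integral_mono (μ := ν w) (integrable_of_continuous (hcone n w).continuous _)
      (integrable_const (r * normalizedIter θ f φ ν n w x))
      (fun y => hc.le_mul _ (hcone n w) y x)
    rw [integral_normalizedIter hg hν] at this
    rw [inv_le_iff_one_le_mul₀ hr, mul_comm]
    simpa using this
  have hhol : ∀ w x y, h w x - h w y ≤ C * r * dist x y ^ β := fun w x y => by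
    refine le_of_tendsto ((hh w x).sub (hh w y)) (Eventually.of_forall fun n => ?_)
    refine ((hcone n w).sub_le hβ.le hc.nonneg x y).trans ?_
    have := hup n w x
    have := hc.nonneg
    gcongr
  have hmeas : Measurable fun p : X × M => h p.1 p.2 :=
    measurable_of_tendsto_metrizable (fun n => measurable_normalizedIter hg hf hfc hφ ν n)
      (tendsto_pi_nhds.2 fun p => hh p.1 p.2)
  have hb : ∀ w x, r⁻¹ ≤ h w x ∧ h w x ≤ r := fun w x =>
    ⟨ge_of_tendsto (hh w x) (Eventually.of_forall fun n => hlow n w x),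
      le_of_tendsto (hh w x) (Eventually.of_forall fun n => hup n w x)⟩
  refine ⟨h, hmeas, hh, hhol, hb, fun w x => ?_, fun w => ?_⟩
  · obtain ⟨n, -, henum⟩ := (hg w).exists_enum
    obtain ⟨a, ha⟩ := henum x
    have h1 : Tendsto (fun k => transfer (f w) (φ w) (normalizedIter θ f φ ν k w) x) atTop
        (𝓝 (transfer (f w) (φ w) (h w) x)) := by
      simp only [ha.transfer_eq]
      exact tendsto_finsetSum _ fun i _ => (hh w (a i)).const_mul _
    simp only [transfer_normalizedIter hg] at h1
    exact tendsto_nhds_unique h1 (((hh (θ w) x).comp (tendsto_add_atTop_nat 1)).const_mul _)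
  · have h1 : Tendsto (fun n => ∫ x, normalizedIter θ f φ ν n w x ∂(ν w)) atTop
        (𝓝 (∫ x, h w x ∂(ν w))) := by
      refine tendsto_integral_of_dominated_convergence (fun _ => r)
        (fun n => (hcone n w).continuous.aestronglyMeasurable) (integrable_const _)
        (fun n => Eventually.of_forall fun x => ?_) (Eventually.of_forall fun x => hh w x)
      rw [Real.norm_eq_abs, abs_of_pos ((hcone n w).pos x)]
      exact hup n w x
    simp only [integral_normalizedIter hg hν] at h1
    exact tendsto_nhds_unique h1 tendsto_const_nhds

end Density

/-! ### Almost sure uniqueness of probabilities and densities -/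

section Uniqueness

variable {X M : Type*} [MeasurableSpace X] [MetricSpace M] [CompactSpace M] [Nonempty M]
  [MeasurableSpace M] [BorelSpace M] {θ : X ≃ᵐ X} {f : X → M → M} {φ : X → M → ℝ} {γ : ℝ}
  {P : Measure X}

theorem ae_iterate {T : X → X} (hT : MeasurePreserving T P P) {p : X → Prop}
    (hp : ∀ᵐ w ∂P, p w) : ∀ᵐ w ∂P, ∀ n : ℕ, p (T^[n] w) :=
  ae_all_iff.2 fun n => (hT.iterate n).quasiMeasurePreserving.ae hp

/-- On almost every orbit the duality holds at all forward times, and then both families are limits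
of the same quotients. -/
theorem IsReferenceFamily.ae_eq (hθ : MeasurePreserving θ P P)
    (hg : ∀ w, MeanContracting (f w) (φ w) γ) {β : ℝ} (hβ : 0 < β) (hβ1 : β ≤ 1)
    (hcone : ∀ C₀ : ℝ, ∃ (C r : ℝ) (η : ℕ → ℝ), C₀ ≤ C ∧ ContractsCone θ f φ β C r η)
    {ν ν' : Kernel X M} [IsMarkovKernel ν] [IsMarkovKernel ν']
    (h : IsReferenceFamily P θ f φ ν) (h' : IsReferenceFamily P θ f φ ν') :
    ∀ᵐ w ∂P, ν' w = ν w := by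
  filter_upwards [ae_iterate hθ h, ae_iterate hθ h'] with w hw hw'
  refine eq_of_forall_logCone hβ hβ1 fun C₀ ψ hψ => ?_
  obtain ⟨C, r, η, hC, hc⟩ := hcone C₀
  obtain ⟨x₀⟩ : Nonempty M := inferInstance
  exact tendsto_nhds_unique
    (hc.tendsto_integral hg (fun k χ hχ => hw' k ⟨χ, hχ⟩) (hψ.mono hC) x₀)
    (hc.tendsto_integral hg (fun k χ hχ => hw k ⟨χ, hχ⟩) (hψ.mono hC) x₀)

omit [CompactSpace M] [Nonempty M] [BorelSpace M] in
-- A density reproduces itself under normalized iteration from the past, so its distance to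
-- `normalizedIter` is governed by the cone contraction.
theorem iterTransfer_density {ν : Kernel X M} (hg : ∀ w, MeanContracting (f w) (φ w) γ)
    {h : X → M → ℝ} {w : X} (heq : ∀ n x, transfer (f (θ.symm^[n] w)) (φ (θ.symm^[n] w))
      (h (θ.symm^[n] w)) x = eigenvalue θ f φ ν (θ.symm^[n] w) * h (θ (θ.symm^[n] w)) x)
    (n : ℕ) (x : M) : iterTransfer θ f φ n (θ.symm^[n] w) (h (θ.symm^[n] w)) x =
      (∏ k ∈ Finset.range n, eigenvalue θ f φ ν (θ^[k] (θ.symm^[n] w))) * h w x := by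
  induction n with
  | zero => simp [iterTransfer]
  | succ n ih =>
    have h1 : transfer (f (θ.symm^[n + 1] w)) (φ (θ.symm^[n + 1] w)) (h (θ.symm^[n + 1] w)) =
        fun x => eigenvalue θ f φ ν (θ.symm^[n + 1] w) * h (θ (θ.symm^[n + 1] w)) x :=
      funext fun x => heq (n + 1) x
    have h2 : θ (θ.symm^[n + 1] w) = θ.symm^[n] w := by
      rw [Function.iterate_succ_apply', θ.apply_symm_apply]
    rw [iterTransfer, h1, iterTransfer_const_mul hg, h2, Finset.prod_range_succ']
    simp only [ih, Function.iterate_succ_apply θ, h2, Function.iterate_zero, id_eq]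
    ring

omit [CompactSpace M] [MeasurableSpace M] [BorelSpace M] in
/-- Hölder bounds on a dense sequence put a continuous function into a cone. -/
theorem logCone_of_dense {d : ℕ → M} (hd : DenseRange d) {ψ : M → ℝ} (hψ : Continuous ψ)
    {β β' K D : ℝ} (hβ : 0 < β) (hβ' : β ≤ β') (hK : 0 < K) (hD : ∀ x y : M, dist x y ≤ D)
    (hhol : ∀ i j, |ψ (d i) - ψ (d j)| ≤ K * dist (d i) (d j) ^ β')
    (hb : ∀ i, K⁻¹ ≤ ψ (d i) ∧ ψ (d i) ≤ K) :
    LogCone β (K * D ^ (β' - β) / K⁻¹ * (K / K⁻¹) ^ β) ψ := by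
  have hb' : ∀ x, K⁻¹ ≤ ψ x ∧ ψ x ≤ K := fun x =>
    hd.induction_on x ((isClosed_le continuous_const hψ).inter (isClosed_le hψ continuous_const)) hb
  have hhol' : ∀ x y, |ψ x - ψ y| ≤ K * dist x y ^ β' := fun x y => by
    refine DenseRange.induction_on₂ (p := fun x y => |ψ x - ψ y| ≤ K * dist x y ^ β') hd ?_
      hhol x y
    exact isClosed_le (((hψ.comp continuous_fst).sub (hψ.comp continuous_snd)).abs)
      (continuous_const.mul ((continuous_fst.dist continuous_snd).rpow_const
        fun _ => Or.inr (by linarith)))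
  have hDn : 0 ≤ D := let ⟨x⟩ : Nonempty M := inferInstance; dist_nonneg.trans (hD x x)
  refine logCone_of_holder hβ.le hψ (inv_pos.2 hK)
    (mul_nonneg hK.le (Real.rpow_nonneg hDn _)) (fun x => (hb' x).1) (fun x => (hb' x).2)
    fun x y => ?_
  rw [mul_assoc]
  exact (le_abs_self _).trans ((hhol' x y).trans
    (mul_le_mul_of_nonneg_left (dist_rpow_le hD hβ hβ' x y) hK.le))

/-- Uniqueness of the densities. -/
theorem density_ae_eq [PreconnectedSpace M] [IsFiniteMeasure P] (hθ : MeasurePreserving θ P P)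
    (hg : ∀ w, MeanContracting (f w) (φ w) γ) {β₀ : ℝ} (hβ₀ : 0 < β₀)
    (hcone : ∀ β : ℝ, 0 < β → β ≤ β₀ → ∀ C₀ : ℝ, ∃ (C r : ℝ) (η : ℕ → ℝ), C₀ ≤ C ∧
      ContractsCone θ f φ β C r η)
    {ν : Kernel X M} [IsMarkovKernel ν] (hν : ∀ w (ψ : M → ℝ), Continuous ψ →
      ∫ x, transfer (f w) (φ w) ψ x ∂(ν (θ w)) = eigenvalue θ f φ ν w * ∫ x, ψ x ∂(ν w))
    {h : X → M → ℝ}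
    (hh : ∀ w x, Tendsto (fun n => normalizedIter θ f φ ν n w x) atTop (𝓝 (h w x)))
    {h' : X → M → ℝ} (hm : Measurable fun p : X × M => h' p.1 p.2)
    (hhol : ∀ᵐ w ∂P, ∃ β : ℝ≥0, 0 < β ∧ MemHolder β (h' w))
    (hbd : ∀ᵐ w ∂P, ∃ R : ℝ, 0 < R ∧ ∀ x, R⁻¹ ≤ h' w x ∧ h' w x ≤ R)
    (hinv : IsInvariantDensity P θ f φ ν h') : ∀ᵐ w ∂P, h' w = h w := by
  obtain ⟨D, hD1, hD⟩ := exists_dist_le M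
  set d := TopologicalSpace.denseSeq M
  have hd : DenseRange d := TopologicalSpace.denseRange_denseSeq M
  -- One parameter controls Hölder constant, exponent and bounds together. Testing on a dense
  -- sequence keeps the set measurable.
  set S : ℕ → Set X := fun k => {w | (∀ i j, |h' w (d i) - h' w (d j)| ≤
      ((k : ℝ) + 1) * dist (d i) (d j) ^ (1 / ((k : ℝ) + 1))) ∧
      ∀ i, ((k : ℝ) + 1)⁻¹ ≤ h' w (d i) ∧ h' w (d i) ≤ (k : ℝ) + 1} with hS
  have hmd : ∀ i, Measurable fun w => h' w (d i) := fun i =>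
    hm.comp (measurable_id.prodMk measurable_const)
  have hSm : ∀ k, MeasurableSet (S k) := fun k => by
    refine MeasurableSet.inter (s₁ := {w | ∀ i j, |h' w (d i) - h' w (d j)| ≤
      ((k : ℝ) + 1) * dist (d i) (d j) ^ (1 / ((k : ℝ) + 1))}) (s₂ := {w | ∀ i,
        ((k : ℝ) + 1)⁻¹ ≤ h' w (d i) ∧ h' w (d i) ≤ (k : ℝ) + 1}) ?_ ?_
    · simp only [ofPred_forall]
      refine MeasurableSet.iInter fun i => MeasurableSet.iInter fun j => ?_
      exact measurableSet_le (continuous_abs.measurable.comp ((hmd i).sub (hmd j)))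
        measurable_const
    · simp only [ofPred_forall]
      refine MeasurableSet.iInter fun i => ?_
      exact (measurableSet_le measurable_const (hmd i)).inter
        (measurableSet_le (hmd i) measurable_const)
  have hcover : ∀ᵐ w ∂P, ∃ k, w ∈ S k := by
    filter_upwards [hhol, hbd] with w hw1 hw2
    obtain ⟨β, hβ, K, hK⟩ := hw1
    obtain ⟨R, hR, hRb⟩ := hw2
    have hβ' : (0 : ℝ) < β := hβ
    obtain ⟨k, hk⟩ := exists_nat_ge (max (1 / (β : ℝ)) (max R (K * D ^ (β : ℝ))))
    have hk1 := (le_max_left _ _).trans hk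
    have hk2 := ((le_max_left _ _).trans (le_max_right _ _)).trans hk
    have hk3 := ((le_max_right _ _).trans (le_max_right _ _)).trans hk
    have hk0 : (0 : ℝ) < (k : ℝ) + 1 := by positivity
    refine ⟨k, fun i j => ?_, fun i => ⟨?_, ?_⟩⟩
    · have h1 := hK.dist_le (d i) (d j)
      rw [Real.dist_eq] at h1
      have hkβ : 1 / ((k : ℝ) + 1) ≤ β := by
        rw [div_le_iff₀ hβ'] at hk1
        rw [div_le_iff₀ hk0]
        nlinarith
      have h2 := dist_rpow_le hD (one_div_pos.2 hk0) hkβ (d i) (d j)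
      have h3 : D ^ ((β : ℝ) - 1 / ((k : ℝ) + 1)) ≤ D ^ (β : ℝ) :=
        Real.rpow_le_rpow_of_exponent_le hD1 (by linarith [one_div_pos.2 hk0])
      calc |h' w (d i) - h' w (d j)| ≤ K * dist (d i) (d j) ^ (β : ℝ) := h1
        _ ≤ K * (D ^ ((β : ℝ) - 1 / ((k : ℝ) + 1)) *
            dist (d i) (d j) ^ (1 / ((k : ℝ) + 1))) := by gcongr
        _ ≤ K * (D ^ (β : ℝ) * dist (d i) (d j) ^ (1 / ((k : ℝ) + 1))) := by gcongr
        _ = (K * D ^ (β : ℝ)) * dist (d i) (d j) ^ (1 / ((k : ℝ) + 1)) := by ring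
        _ ≤ _ := by
          gcongr
          linarith
    · exact (inv_anti₀ hR (by linarith)).trans (hRb (d i)).1
    · exact (hRb (d i)).2.trans (by linarith)
  -- Poincaré recurrence for `θ⁻¹`: the past orbit meets infinitely often the set where the given
  -- bounds hold.
  have hrec : ∀ᵐ w ∂P, ∀ k, w ∈ S k → ∃ᶠ n in atTop, θ.symm^[n] w ∈ S k :=
    ae_all_iff.2 fun k => (hθ.symm θ).conservative.ae_mem_imp_frequently_image_mem
      (hSm k).nullMeasurableSet
  filter_upwards [hcover, hrec, ae_iterate (hθ.symm θ) hinv, ae_iterate (hθ.symm θ) hhol]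
    with w hw1 hw2 hw3 hw4
  obtain ⟨k, hk⟩ := hw1
  have hk0 : (0 : ℝ) < (k : ℝ) + 1 := by positivity
  -- The exponent must suit both the recurrent Hölder bound and the potential; it depends on `k` but
  -- not on the time `n`.
  set β := min (1 / ((k : ℝ) + 1)) β₀ with hβ
  have hβ0 : 0 < β := lt_min (by positivity) hβ₀
  obtain ⟨C, r, η, hC, hc⟩ := hcone β hβ0 (min_le_right _ _)
    (((k : ℝ) + 1) * D ^ (1 / ((k : ℝ) + 1) - β) / ((k : ℝ) + 1)⁻¹ *
      (((k : ℝ) + 1) / ((k : ℝ) + 1)⁻¹) ^ β)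
  funext x
  have hle : ∀ n, θ.symm^[n] w ∈ S k →
      |h' w x - h w x| ≤ |η n| * r + |normalizedIter θ f φ ν n w x - h w x| := by
    intro n hn
    obtain ⟨b, hb, hbH⟩ := hw4 n
    have hcont : Continuous (h' (θ.symm^[n] w)) := by
      obtain ⟨K, hK⟩ := hbH
      exact hK.continuous hb
    have hψ := logCone_of_dense hd hcont hβ0 (min_le_left _ _) hk0 hD hn.1 hn.2
    have h1 := hc.abs_normalizedIter_sub_le hg hν n w (hψ.mono hC) (hw3 n).2 x
    rw [iterTransfer_density hg (fun n => (hw3 n).1),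
      inv_mul_cancel_left₀ (prod_eigenvalue_pos hg ν n _).ne'] at h1
    exact (abs_sub_le _ (normalizedIter θ f φ ν n w x) _).trans (add_le_add_left h1 _)
  have hlim : Tendsto (fun n => |η n| * r + |normalizedIter θ f φ ν n w x - h w x|) atTop
      (𝓝 0) := by
    have h1 := (hc.tendsto.abs.mul_const r).add ((hh w x).sub_const (h w x)).abs
    simpa using h1
  have := ge_of_tendsto_of_frequently hlim ((hw2 k hk).mono hle)
  exact sub_eq_zero.1 (abs_eq_zero.1 (le_antisymm this (abs_nonneg _)))

end Uniqueness

/-! ### Invariance under the skew product -/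

section Invariance

variable {X M : Type*} [MeasurableSpace X] [MetricSpace M] [CompactSpace M]
  [MeasurableSpace M] [BorelSpace M] {θ : X ≃ᵐ X} {f : X → M → M} {φ : X → M → ℝ} {γ : ℝ}
  {P : Measure X} {ν : Kernel X M} [IsMarkovKernel ν] {h : X → M → ℝ}

omit [MetricSpace M] [CompactSpace M] [BorelSpace M] in
theorem integral_fiber_eq (hm : Measurable fun p : X × M => h p.1 p.2)
    (h0 : ∀ w x, 0 ≤ h w x) (w : X) (ψ : M → ℝ) :
    ∫ x, ψ x ∂(ν.withDensity (fun w x => ENNReal.ofReal (h w x)) w) =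
      ∫ x, ψ x * h w x ∂(ν w) := by
  have hmw : Measurable (h w) := hm.comp (measurable_const.prodMk measurable_id)
  rw [Kernel.withDensity_apply _ (show Measurable (Function.uncurry fun w x =>
      ENNReal.ofReal (h w x)) from ENNReal.measurable_ofReal.comp hm),
    integral_withDensity_eq_integral_toReal_smul hmw.ennreal_ofReal
      (Eventually.of_forall fun _ => ENNReal.ofReal_lt_top)]
  refine integral_congr_ae (Eventually.of_forall fun x => ?_)
  simp only [ENNReal.toReal_ofReal (h0 w x), smul_eq_mul, mul_comm]

theorem isMarkovKernel_withDensity (hm : Measurable fun p : X × M => h p.1 p.2)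
    (hc : ∀ w, Continuous (h w)) (h0 : ∀ w x, 0 ≤ h w x) (hi : ∀ w, ∫ x, h w x ∂(ν w) = 1) :
    IsMarkovKernel (ν.withDensity fun w x => ENNReal.ofReal (h w x)) := by
  refine ⟨fun w => ⟨?_⟩⟩
  rw [Kernel.withDensity_apply' _ (show Measurable (Function.uncurry fun w x =>
      ENNReal.ofReal (h w x)) from ENNReal.measurable_ofReal.comp hm), Measure.restrict_univ,
    ← ofReal_integral_eq_lintegral_ofReal (integrable_of_continuous (hc w) _)
      (Eventually.of_forall (h0 w)), hi, ENNReal.ofReal_one]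

/-- The fibre measures are mapped to each other. -/
theorem map_withDensity_eq (hg : ∀ w, MeanContracting (f w) (φ w) γ)
    (hfc : ∀ w, Continuous (f w))
    (hν : ∀ w (ψ : M → ℝ), Continuous ψ →
      ∫ x, transfer (f w) (φ w) ψ x ∂(ν (θ w)) = eigenvalue θ f φ ν w * ∫ x, ψ x ∂(ν w))
    (hpos : ∀ w, 0 < eigenvalue θ f φ ν w)
    (hm : Measurable fun p : X × M => h p.1 p.2) (hc : ∀ w, Continuous (h w))
    (h0 : ∀ w x, 0 ≤ h w x) (hi : ∀ w, ∫ x, h w x ∂(ν w) = 1)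
    (heq : ∀ w x, transfer (f w) (φ w) (h w) x = eigenvalue θ f φ ν w * h (θ w) x) (w : X) :
    (ν.withDensity (fun w x => ENNReal.ofReal (h w x)) w).map (f w) =
      ν.withDensity (fun w x => ENNReal.ofReal (h w x)) (θ w) := by
  have := isMarkovKernel_withDensity hm hc h0 hi
  refine ext_of_forall_integral_eq_of_IsFiniteMeasure fun ψ => ?_
  rw [integral_map (hfc w).aemeasurable ψ.continuous.aestronglyMeasurable,
    integral_fiber_eq hm h0 w fun x => ψ (f w x), integral_fiber_eq hm h0]
  -- The function `ψ ∘ f w` is constant on the fibres of `f w` and comes out of the transfer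
  -- operator, so the duality turns into the change of variables and the eigenvalue cancels.
  have h1 := hν w (fun x => ψ (f w x) * h w x) ((ψ.continuous.comp (hfc w)).mul (hc w))
  have h2 : ∀ x, transfer (f w) (φ w) (fun x => ψ (f w x) * h w x) x =
      eigenvalue θ f φ ν w * (ψ x * h (θ w) x) := fun x => by
    obtain ⟨n, -, henum⟩ := (hg w).exists_enum
    obtain ⟨a, ha⟩ := henum x
    have h3 := heq w x
    rw [ha.transfer_eq] at h3 ⊢
    simp only [ha.apply]
    rw [mul_left_comm, ← h3, Finset.mul_sum]
    exact Finset.sum_congr rfl fun i _ => by ring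
  simp only [h2, integral_const_mul] at h1
  exact (mul_left_cancel₀ (hpos w).ne' h1).symm

omit [MetricSpace M] [CompactSpace M] [BorelSpace M] in
theorem measurePreserving_skewProduct [SFinite P] (hθ : MeasurePreserving θ P P)
    (hf : Measurable fun p : X × M => f p.1 p.2) {κ : Kernel X M} [IsMarkovKernel κ]
    (hκ : ∀ w, (κ w).map (f w) = κ (θ w)) :
    MeasurePreserving (skewProduct θ f) (P ⊗ₘ κ) (P ⊗ₘ κ) := by
  have hF : Measurable (skewProduct θ f) :=
    (θ.measurable.comp measurable_fst).prodMk hf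
  refine ⟨hF, Measure.ext_of_lintegral _ fun g hgm => ?_⟩
  rw [lintegral_map hgm hF,
    Measure.lintegral_compProd (f := fun p => g (skewProduct θ f p)) (hgm.comp hF),
    Measure.lintegral_compProd hgm, ← hθ.lintegral_comp hgm.lintegral_kernel_prod_right']
  refine lintegral_congr fun w => ?_
  have hgw : Measurable fun y => g (θ w, y) := hgm.comp (measurable_const.prodMk measurable_id)
  have hfw : Measurable (f w) := hf.comp (measurable_const.prodMk measurable_id)
  rw [← hκ w, lintegral_map hgw hfw]
  rfl

end Invariance

/-! ### Regularity of the potential and mean contraction -/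

section Constants

variable {X M : Type*} [MetricSpace M]

/-- Consequences of the bound on the Hölder norm of `e^φ`. -/
theorem exp_sub_exp_le {α : ℝ≥0} {ε : ℝ} {φ : M → ℝ}
    (h : eHolderNorm α (fun x => Real.exp (φ x)) < ENNReal.ofReal (ε * Real.exp (⨅ x, φ x)))
    (x y : M) : Real.exp (φ x) - Real.exp (φ y) ≤
      ε * Real.exp (⨅ x, φ x) * dist x y ^ (α : ℝ) := by
  unfold eHolderNorm at h
  simp only [iInf_lt_iff] at h
  obtain ⟨C, hC, hlt⟩ := h
  have h1 := hC.dist_le x y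
  rw [Real.dist_eq] at h1
  have h2 : (C : ℝ) < ε * Real.exp (⨅ x, φ x) := by
    have h3 := ENNReal.toReal_mono ENNReal.ofReal_ne_top hlt.le
    have h4 : 0 < ENNReal.ofReal (ε * Real.exp (⨅ x, φ x)) := bot_le.trans_lt hlt
    rw [ENNReal.ofReal_pos] at h4
    rw [← ENNReal.ofReal_coe_nnreal] at hlt
    exact (ENNReal.ofReal_lt_ofReal_iff h4).1 hlt
  exact (le_abs_self _).trans (h1.trans
    (mul_le_mul_of_nonneg_right h2.le (Real.rpow_nonneg dist_nonneg _)))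

theorem holderWith_of_sub_le {K β : ℝ≥0} {ψ : M → ℝ}
    (h : ∀ x y, ψ x - ψ y ≤ K * dist x y ^ (β : ℝ)) : HolderWith K β ψ := by
  intro x y
  have h1 : dist (ψ x) (ψ y) ≤ K * dist x y ^ (β : ℝ) := by
    rw [Real.dist_eq, abs_sub_le_iff]
    exact ⟨h x y, dist_comm y x ▸ h y x⟩
  rw [edist_dist, edist_dist, ENNReal.ofReal_rpow_of_nonneg dist_nonneg β.coe_nonneg,
    ← ENNReal.ofReal_coe_nnreal, ← ENNReal.ofReal_mul NNReal.zero_le_coe]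
  exact ENNReal.ofReal_le_ofReal h1

/-- On a geodesic space, Hölder functions with exponent greater than one are constant. -/
theorem eq_of_memHolder_of_one_lt (hgeo : IsGeodesicDist M) {α : ℝ≥0} (hα : 1 < α) {φ : M → ℝ}
    (hφ : MemHolder α φ) (x y : M) : φ x = φ y := by
  refine hφ.nnHolderNorm_eq_zero.1 ?_ x y
  set H := nnHolderNorm α φ with hH
  have hα' : (1 : ℝ) < α := hα
  have hHol : HolderWith H α φ := hφ.holderWith
  -- Passing through a midpoint multiplies any Hölder constant by `2 ^ (1 - α) < 1`, so the best
  -- constant is zero.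
  have key : HolderWith ((2 : ℝ≥0) ^ (1 - (α : ℝ)) * H) α φ := by
    refine holderWith_of_sub_le fun x y => ?_
    obtain ⟨z, hz1, hz2⟩ := hgeo x y (dist x y / 2)
      ⟨by positivity, by linarith [dist_nonneg (x := x) (y := y)]⟩
    have hz2' : dist z y = dist x y / 2 := by rw [hz2]; ring
    have e1 := hHol.dist_le x z
    have e2 := hHol.dist_le z y
    rw [hz1] at e1
    rw [hz2'] at e2
    have hpow : (dist x y / 2) ^ (α : ℝ) = 2 ^ (1 - (α : ℝ)) / 2 * dist x y ^ (α : ℝ) := by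
      rw [Real.div_rpow dist_nonneg (by norm_num), Real.rpow_sub (by norm_num), Real.rpow_one]
      field_simp
    have h1 : dist (φ x) (φ y) ≤ 2 ^ (1 - (α : ℝ)) * H * dist x y ^ (α : ℝ) := by
      calc dist (φ x) (φ y) ≤ dist (φ x) (φ z) + dist (φ z) (φ y) := dist_triangle _ _ _
        _ ≤ H * (dist x y / 2) ^ (α : ℝ) + H * (dist x y / 2) ^ (α : ℝ) := add_le_add e1 e2
        _ = _ := by rw [hpow]; ring
    exact (le_abs_self _).trans (by simpa [Real.dist_eq] using h1)
  have h1 : H ≤ (2 : ℝ≥0) ^ (1 - (α : ℝ)) * H := key.nnholderNorm_le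
  have h2 : (2 : ℝ≥0) ^ (1 - (α : ℝ)) < 1 :=
    NNReal.rpow_lt_one_of_one_lt_of_neg (by norm_num) (by linarith)
  by_contra hne
  have h3 : (2 : ℝ≥0) ^ (1 - (α : ℝ)) * H < 1 * H :=
    mul_lt_mul_of_pos_right h2 (pos_iff_ne_zero.2 hne)
  rw [one_mul] at h3
  exact absurd h1 (not_le.2 h3)

variable [CompactSpace M] [Nonempty M]

theorem sub_le_of_exp_sub_exp_le {α : ℝ≥0} {ε : ℝ} (hε : 0 ≤ ε) {φ : M → ℝ} (hφ : Continuous φ)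
    (h : ∀ x y, Real.exp (φ x) - Real.exp (φ y) ≤ ε * Real.exp (⨅ x, φ x) * dist x y ^ (α : ℝ))
    (x y : M) : φ x - φ y ≤ ε * dist x y ^ (α : ℝ) := by
  obtain ⟨z, hz, hle⟩ := exists_eq_iInf_of_continuous hφ
  have h1 := Real.add_one_le_exp (φ x - φ y)
  rw [Real.exp_sub] at h1
  have hy := Real.exp_pos (φ y)
  have h2 : Real.exp (⨅ x, φ x) ≤ Real.exp (φ y) := Real.exp_le_exp.2 (hz ▸ hle y)
  have h3 : Real.exp (φ x) / Real.exp (φ y) - 1 ≤ ε * dist x y ^ (α : ℝ) := by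
    rw [div_sub_one hy.ne', div_le_iff₀ hy]
    have hd : 0 ≤ dist x y ^ (α : ℝ) := Real.rpow_nonneg dist_nonneg _
    calc _ ≤ ε * Real.exp (⨅ x, φ x) * dist x y ^ (α : ℝ) := h x y
      _ ≤ ε * Real.exp (φ y) * dist x y ^ (α : ℝ) := by gcongr
      _ = _ := by ring
  linarith

/-- Pairings at small cost and small variation of `e^φ` give mean contraction. -/
theorem meanContracting_of_hasPairing {g : M → M} {n : ℕ} {c γ u : ℝ} {φ : M → ℝ}
    (hφ : Continuous φ) (hn : 0 < n) (hu : 0 ≤ u)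
    (hpair : ∀ x y, HasPairing g n c x y)
    (hup : ∀ x, Real.exp (φ x) ≤ (1 + u) * Real.exp (⨅ x, φ x))
    (hc : (1 + u) * c ≤ γ * n) : MeanContracting g φ γ := by
  obtain ⟨z, hz, hle⟩ := exists_eq_iInf_of_continuous hφ
  refine ⟨hφ, n, Real.exp (⨅ x, φ x), hn, Real.exp_pos _,
    fun x => Real.exp_le_exp.2 (hz ▸ hle x), fun x y => ?_⟩
  obtain ⟨a, b, ha, hb, hab⟩ := hpair x y
  have hl := Real.exp_pos (⨅ x, φ x)
  set l := Real.exp (⨅ x, φ x)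
  refine ⟨a, b, ha, hb, ?_⟩
  calc ∑ i, Real.exp (φ (a i)) * dist (a i) (b i) ≤ ∑ i, (1 + u) * l * dist (a i) (b i) :=
        Finset.sum_le_sum fun i _ => mul_le_mul_of_nonneg_right (hup _) dist_nonneg
    _ = (1 + u) * l * ∑ i, dist (a i) (b i) := by rw [Finset.mul_sum]
    _ ≤ (1 + u) * l * (c * dist x y) := mul_le_mul_of_nonneg_left hab (by positivity)
    _ = ((1 + u) * c) * (l * dist x y) := by ring
    _ ≤ (γ * n) * (l * dist x y) := mul_le_mul_of_nonneg_right hc (by positivity)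
    _ = _ := by ring

end Constants

/-! ### Numerical consequences of the cone condition -/

section ConeConst

variable {n q : ℕ} {σ L ε m D γ : ℝ} {α : ℝ≥0}

theorem coneConst_terms_nonneg (hq : q < n) (hσ : 1 < σ) (hL : 1 ≤ L) :
    0 ≤ ((n : ℝ) - q) * σ ^ (-(α : ℝ)) + q * L ^ (α : ℝ) * (1 + (L - 1) ^ (α : ℝ)) := by
  have h1 : (0 : ℝ) < (n : ℝ) - q := sub_pos.2 (by exact_mod_cast hq)
  have h2 : 0 ≤ (L - 1) ^ (α : ℝ) := Real.rpow_nonneg (by linarith) _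
  positivity

theorem coneConst_nonneg (hq : q < n) (hσ : 1 < σ) (hL : 1 ≤ L) (hε : 0 < ε) (hm : 1 ≤ m)
    (hD : 0 ≤ D) : 0 ≤ coneConst n q σ L α ε m D := by
  have h1 := coneConst_terms_nonneg (α := α) hq hσ hL
  unfold coneConst
  positivity

/-- For exponents at most one, the constant of condition (V) bounds the weighted mean cost. -/
theorem mean_cost_le_of_le_one (hq : q < n) (hσ : 1 < σ) (hL : 1 ≤ L) (hL2 : L ≤ 2) (hε : 0 < ε)
    (hm : 1 ≤ m) (hD : 0 ≤ D) (hα : α ≤ 1) (hγ : γ < 1)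
    (hV : coneConst n q σ L α ε m D ≤ γ) :
    (1 + ε * D ^ (α : ℝ)) * (((n : ℝ) - q) * σ⁻¹ + q * L) ≤ γ * n := by
  have hS := coneConst_terms_nonneg (α := α) hq hσ hL
  have hα' : (α : ℝ) ≤ 1 := hα
  have hn : (0 : ℝ) < n := by exact_mod_cast (Nat.zero_le q).trans_lt hq
  have hnq : (0 : ℝ) ≤ (n : ℝ) - q := sub_nonneg.2 (by exact_mod_cast hq.le)
  have hs : 0 ≤ (L - 1) ^ (α : ℝ) := Real.rpow_nonneg (by linarith) _
  have hLα : 1 ≤ L ^ (α : ℝ) := Real.one_le_rpow hL α.2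
  have h1 : σ⁻¹ ≤ σ ^ (-(α : ℝ)) := by
    rw [← Real.rpow_neg_one]
    exact Real.rpow_le_rpow_of_exponent_le hσ.le (by linarith)
  -- Since `L ≤ 2`, the number `L - 1` lies in `[0, 1]` and is at most its power with exponent `α ≤
  -- 1`.
  have h2 : L ≤ L ^ (α : ℝ) * (1 + (L - 1) ^ (α : ℝ)) := by
    have h3 : L - 1 ≤ (L - 1) ^ (α : ℝ) := by
      rcases (sub_nonneg.2 hL).eq_or_lt with h | h
      · rw [← h]; exact Real.rpow_nonneg le_rfl _
      · calc L - 1 = (L - 1) ^ (1 : ℝ) := (Real.rpow_one _).symm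
          _ ≤ _ := Real.rpow_le_rpow_of_exponent_ge h (by linarith) hα'
    nlinarith
  set S := ((n : ℝ) - q) * σ ^ (-(α : ℝ)) + q * L ^ (α : ℝ) * (1 + (L - 1) ^ (α : ℝ)) with hSdef
  have hcS : ((n : ℝ) - q) * σ⁻¹ + q * L ≤ S := by
    rw [hSdef, mul_assoc (q : ℝ)]
    gcongr
  unfold coneConst at hV
  rw [← hSdef] at hV
  have hSn : 0 ≤ S / n := div_nonneg hS hn.le
  have he : 1 ≤ Real.exp ε := Real.one_le_exp hε.le
  set u := ε * D ^ (α : ℝ) with hu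
  have hu0 : 0 ≤ u := by positivity
  have h5 : S / n ≤ Real.exp ε * (S / n) := le_mul_of_one_le_left hSn he
  have h6 : u ≤ ε * L ^ (α : ℝ) * (m * D ^ (α : ℝ)) := by
    have h7 : 1 ≤ L ^ (α : ℝ) * m := one_le_mul_of_one_le_of_one_le hLα hm
    calc u = u * 1 := (mul_one _).symm
      _ ≤ u * (L ^ (α : ℝ) * m) := mul_le_mul_of_nonneg_left h7 hu0
      _ = _ := by rw [hu]; ring
  have h8 : 0 ≤ ε * L ^ (α : ℝ) := by positivity
  have h9 : S / n + u ≤ γ := by linarith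
  -- As `S / n ≤ γ < 1`, the product is at most `S / n + u`.
  have h10 : (1 + u) * (S / n) ≤ γ := by nlinarith
  calc (1 + u) * (((n : ℝ) - q) * σ⁻¹ + q * L) ≤ (1 + u) * S :=
        mul_le_mul_of_nonneg_left hcS (by linarith)
    _ = (1 + u) * (S / n) * n := by field_simp
    _ ≤ γ * n := mul_le_mul_of_nonneg_right h10 hn.le

/-- For exponents greater than one, the mean cost is bounded by convexity. -/
theorem mean_cost_le_of_one_le (hq : q < n) (hσ : 1 < σ) (hL : 1 ≤ L) (hε : 0 < ε)
    (hm : 1 ≤ m) (hD : 0 ≤ D) (hα : 1 ≤ α)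
    (hV : coneConst n q σ L α ε m D ≤ γ) :
    ((n : ℝ) - q) * σ⁻¹ + q * L ≤ γ ^ (1 / (α : ℝ)) * n := by
  have hS := coneConst_terms_nonneg (α := α) hq hσ hL
  have hα' : (1 : ℝ) ≤ α := hα
  have hn : (0 : ℝ) < n := by exact_mod_cast (Nat.zero_le q).trans_lt hq
  have hnq : (0 : ℝ) ≤ (n : ℝ) - q := sub_nonneg.2 (by exact_mod_cast hq.le)
  have hs : 0 ≤ (L - 1) ^ (α : ℝ) := Real.rpow_nonneg (by linarith) _
  have hσ0 : 0 < σ := by linarith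
  have hL0 : 0 < L := by linarith
  -- The mean cost per branch is a convex combination of `σ⁻¹` and `L`; convexity bounds its power
  -- `α` by the mean of the powers, which occurs in `coneConst`.
  have hconv := (convexOn_rpow hα').2 (show σ⁻¹ ∈ Ici (0 : ℝ) from inv_nonneg.2 hσ0.le)
    (show L ∈ Ici (0 : ℝ) from hL0.le) (show (0 : ℝ) ≤ ((n : ℝ) - q) / n by positivity)
    (show (0 : ℝ) ≤ (q : ℝ) / n by positivity) (by field_simp; ring)
  simp only [smul_eq_mul] at hconv
  have hc0 : 0 ≤ ((n : ℝ) - q) / n * σ⁻¹ + q / n * L := by positivity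
  have hγ : (((n : ℝ) - q) / n * σ⁻¹ + q / n * L) ^ (α : ℝ) ≤ γ := by
    refine hconv.trans (le_trans ?_ hV)
    unfold coneConst
    set S := ((n : ℝ) - q) * σ ^ (-(α : ℝ)) + q * L ^ (α : ℝ) * (1 + (L - 1) ^ (α : ℝ)) with hSdef
    have h1 : ((n : ℝ) - q) / n * σ⁻¹ ^ (α : ℝ) + q / n * L ^ (α : ℝ) ≤ S / n := by
      rw [Real.inv_rpow hσ0.le, ← Real.rpow_neg hσ0.le, div_mul_eq_mul_div, div_mul_eq_mul_div,
        ← add_div]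
      refine div_le_div_of_nonneg_right ?_ hn.le
      have : 0 ≤ q * L ^ (α : ℝ) * (L - 1) ^ (α : ℝ) := by positivity
      rw [hSdef]
      linarith
    have h2 : S / n ≤ Real.exp ε * (S / n) :=
      le_mul_of_one_le_left (div_nonneg hS hn.le) (Real.one_le_exp hε.le)
    have h3 : 0 ≤ ε * L ^ (α : ℝ) * (1 + m * D ^ (α : ℝ)) := by positivity
    linarith
  have h4 : ((n : ℝ) - q) / n * σ⁻¹ + q / n * L ≤ γ ^ (1 / (α : ℝ)) := by
    have h5 := Real.rpow_le_rpow (Real.rpow_nonneg hc0 _) hγ (z := 1 / (α : ℝ)) (by positivity)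
    rwa [← Real.rpow_mul hc0, mul_one_div_cancel (by positivity), Real.rpow_one] at h5
  calc ((n : ℝ) - q) * σ⁻¹ + q * L = (((n : ℝ) - q) / n * σ⁻¹ + q / n * L) * n := by
        field_simp
    _ ≤ _ := mul_le_mul_of_nonneg_right h4 hn.le

end ConeConst

section Constant

variable {X M : Type*} [MetricSpace M] {θ : X → X} {f : X → M → M} {φ : X → M → ℝ} {γ : ℝ}

/-- For potentials that are constant on fibres, constant functions are preserved. -/
theorem iterTransfer_eq_of_const (hg : ∀ w, MeanContracting (f w) (φ w) γ)
    (hφ : ∀ w x y, φ w x = φ w y) (n : ℕ) (w : X) {ψ : M → ℝ} (hψ : ∀ x y, ψ x = ψ y) (x y : M) :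
    iterTransfer θ f φ n w ψ x = iterTransfer θ f φ n w ψ y := by
  induction n generalizing w ψ with
  | zero => exact hψ x y
  | succ n ih =>
    refine ih _ fun x y => ?_
    obtain ⟨N, -, henum⟩ := (hg w).exists_enum
    obtain ⟨a, ha⟩ := henum x
    obtain ⟨b, hb⟩ := henum y
    rw [ha.transfer_eq, hb.transfer_eq]
    exact Finset.sum_congr rfl fun i _ => by rw [hφ w (a i) (b i), hψ (a i) (b i)]

end Constant

/-! ### Assembly for mean contracting branches -/

section MeanContracting

variable {X M : Type*} [MeasurableSpace X] [MetricSpace M] [CompactSpace M] [ConnectedSpace M]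
  [MeasurableSpace M] [BorelSpace M] {P : Measure X} [IsProbabilityMeasure P] {θ : X ≃ᵐ X}
  {f : X → M → M} {φ : X → M → ℝ} {γ : ℝ}

/-- The thermodynamic formalism for mean contracting inverse branches. The regularity of the
densities is left as a hypothesis on limits of the normalized iterates. -/
theorem exists_reference_density_of_meanContracting (hθ : MeasurePreserving θ P P)
    (hg : ∀ w, MeanContracting (f w) (φ w) γ) (hγ : 0 ≤ γ) (hγ1 : γ < 1)
    (hf : Measurable fun p : X × M => f p.1 p.2) (hfc : ∀ w, Continuous (f w))
    (hφ : Measurable fun p : X × M => φ p.1 p.2) {β₀ E : ℝ} (hβ₀ : 0 < β₀) (hβ₀1 : β₀ ≤ 1)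
    (hE : 0 ≤ E) (hφE : ∀ w x y, φ w x - φ w y ≤ E * dist x y ^ β₀) {α : ℝ≥0}
    (hreg : ∀ (ν : Kernel X M) (h : X → M → ℝ) (K : ℝ), 0 ≤ K →
      (∀ w x, Tendsto (fun n => normalizedIter θ f φ ν n w x) atTop (𝓝 (h w x))) →
      (∀ w x y, h w x - h w y ≤ K * dist x y ^ β₀) → ∀ w, MemHolder α (h w)) :
    ∃ (ν : Kernel X M) (_ : IsMarkovKernel ν),
      IsReferenceFamily P θ f φ ν ∧
      (∀ ν' : Kernel X M, IsMarkovKernel ν' → IsReferenceFamily P θ f φ ν' →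
        ∀ᵐ w ∂P, ν' w = ν w) ∧
      ∃ h : X → M → ℝ,
        Measurable (fun p : X × M => h p.1 p.2) ∧
        (∀ᵐ w ∂P, MemHolder α (h w)) ∧
        (∃ R : ℝ, 0 < R ∧ ∀ᵐ w ∂P, ∀ x, R⁻¹ ≤ h w x ∧ h w x ≤ R) ∧
        IsInvariantDensity P θ f φ ν h ∧
        (∀ h' : X → M → ℝ,
          Measurable (fun p : X × M => h' p.1 p.2) →
          (∀ᵐ w ∂P, ∃ β : ℝ≥0, 0 < β ∧ MemHolder β (h' w)) →
          (∀ᵐ w ∂P, ∃ R : ℝ, 0 < R ∧ ∀ x, R⁻¹ ≤ h' w x ∧ h' w x ≤ R) →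
          IsInvariantDensity P θ f φ ν h' →
          ∀ᵐ w ∂P, h' w = h w) ∧
        IsProbabilityMeasure (fiberMeasure P ν h) ∧
        (fiberMeasure P ν h).map Prod.fst = P ∧
        MeasurePreserving (skewProduct θ f) (fiberMeasure P ν h) (fiberMeasure P ν h) := by
  obtain ⟨D, hD1, hD⟩ := exists_dist_le M
  -- All smaller exponents are needed because a competing density may be Hölder with an arbitrarily
  -- small exponent.
  have hcone : ∀ β : ℝ, 0 < β → β ≤ β₀ → ∀ C₀ : ℝ, ∃ (C r : ℝ) (η : ℕ → ℝ), C₀ ≤ C ∧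
      ContractsCone θ f φ β C r η := fun β hβ hββ₀ C₀ =>
    exists_contractsCone θ hg hγ hγ1 hβ (hββ₀.trans hβ₀1)
      (mul_nonneg hE (Real.rpow_nonneg (one_pos.le.trans hD1) (β₀ - β))) (fun w x y => by
        rw [mul_assoc]
        exact (hφE w x y).trans
          (mul_le_mul_of_nonneg_left (dist_rpow_le hD hβ hββ₀ x y) hE)) C₀
  have hcone₀ := hcone β₀ hβ₀ le_rfl
  obtain ⟨ν, hνm, hν⟩ :=
    exists_conformal_kernel hg hf hfc hφ θ.measurable hβ₀ hβ₀1 hcone₀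
  obtain ⟨C, r, η, -, hc⟩ := hcone₀ 0
  obtain ⟨h, hm, hlim, hhol, hbd, hinv, hint⟩ := hc.exists_density hβ₀ hg hf hfc hφ hν
  have hr : 0 < r := one_pos.trans_le hc.one_le
  have hK : 0 ≤ C * r := mul_nonneg hc.nonneg hr.le
  have h0 : ∀ w x, 0 ≤ h w x := fun w x => (inv_pos.2 hr).le.trans (hbd w x).1
  have hcont : ∀ w, Continuous (h w) := fun w => by
    have hw : HolderWith ⟨C * r, hK⟩ ⟨β₀, hβ₀.le⟩ (h w) :=
      holderWith_of_sub_le fun x y => hhol w x y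
    exact hw.continuous hβ₀
  have hκ : IsMarkovKernel (ν.withDensity fun w x => ENNReal.ofReal (h w x)) :=
    isMarkovKernel_withDensity hm hcont h0 hint
  have href : IsReferenceFamily P θ f φ ν :=
    Eventually.of_forall fun w ψ => hν w ψ ψ.continuous
  refine ⟨ν, hνm, href, fun ν' hν' h' => href.ae_eq hθ hg hβ₀ hβ₀1 hcone₀ h', h, hm,
    Eventually.of_forall (hreg ν h _ hK hlim hhol), ⟨r, hr, Eventually.of_forall hbd⟩,
    Eventually.of_forall fun w => ⟨hinv w, hint w⟩,
    fun h' h1 h2 h3 h4 => density_ae_eq hθ hg hβ₀ hcone hν hlim h1 h2 h3 h4, ?_, ?_, ?_⟩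
  · unfold fiberMeasure
    infer_instance
  · exact Measure.fst_compProd _ _
  · exact measurePreserving_skewProduct hθ hf
      (map_withDensity_eq hg hfc hν (eigenvalue_pos hg ν) hm hcont h0 hint hinv)

end MeanContracting

end RandomTransfer

/-! ### The main theorem -/

theorem theoremA {X M : Type*} [MeasurableSpace X]
    [MetricSpace M] [CompactSpace M] [ConnectedSpace M] [MeasurableSpace M] [BorelSpace M]
    (hgeo : RandomTransfer.IsGeodesicDist M)
    (P : Measure X) [IsProbabilityMeasure P] (θ : X ≃ᵐ X) (hθ : Ergodic θ P)
    (f : X → M → M) (Lip : X → M → ℝ) (hf : RandomTransfer.IsRandomLocalHomeo f Lip)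
    (A : X → Set M) (σ L : X → ℝ) (q : X → ℕ)
    (hexp : RandomTransfer.IsNonUniformlyExpanding θ f Lip A σ L q)
    (α : ℝ≥0) (hα : 0 < α)
    (φ : X → M → ℝ) (hφ : RandomTransfer.IsHolderPotential P α φ)
    (ε : ℝ) (hε : 0 < ε) (hIV : RandomTransfer.IsSmallVariation f q α ε φ)
    (δ : ℝ) (hδ : 0 < δ) (m : ℝ) (hm : RandomTransfer.IsHolderGlobalConst M δ α m)
    (γ : ℝ) (hγ : γ < 1)
    (hV : ∀ w, RandomTransfer.coneConst (RandomTransfer.degree (f w)) (q w) (σ w) (L w) α ε m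
      (Metric.diam (univ : Set M)) ≤ γ) :
    ∃ (ν : Kernel X M) (_ : IsMarkovKernel ν),
      -- (1) existence and uniqueness of the reference probabilities
      RandomTransfer.IsReferenceFamily P θ f φ ν ∧
      (∀ ν' : Kernel X M, IsMarkovKernel ν' → RandomTransfer.IsReferenceFamily P θ f φ ν' →
        ∀ᵐ w ∂P, ν' w = ν w) ∧
      ∃ h : X → M → ℝ,
        -- (2) existence and uniqueness of the densities
        Measurable (fun p : X × M => h p.1 p.2) ∧
        (∀ᵐ w ∂P, MemHolder α (h w)) ∧
        (∃ R : ℝ, 0 < R ∧ ∀ᵐ w ∂P, ∀ x, R⁻¹ ≤ h w x ∧ h w x ≤ R) ∧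
        RandomTransfer.IsInvariantDensity P θ f φ ν h ∧
        (∀ h' : X → M → ℝ,
          Measurable (fun p : X × M => h' p.1 p.2) →
          (∀ᵐ w ∂P, ∃ β : ℝ≥0, 0 < β ∧ MemHolder β (h' w)) →
          (∀ᵐ w ∂P, ∃ R : ℝ, 0 < R ∧ ∀ x, R⁻¹ ≤ h' w x ∧ h' w x ≤ R) →
          RandomTransfer.IsInvariantDensity P θ f φ ν h' →
          ∀ᵐ w ∂P, h' w = h w) ∧
        -- (3) invariance of the measure with fibres `h_w ν_w`
        IsProbabilityMeasure (RandomTransfer.fiberMeasure P ν h) ∧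
        (RandomTransfer.fiberMeasure P ν h).map Prod.fst = P ∧
        MeasurePreserving (RandomTransfer.skewProduct θ f)
          (RandomTransfer.fiberMeasure P ν h) (RandomTransfer.fiberMeasure P ν h) := by
  open RandomTransfer in
  have hθP := hθ.toMeasurePreserving
  have hfc : ∀ w, Continuous (f w) := fun w => (hf.localHomeo w).continuous
  have hφc : ∀ w, Continuous (φ w) := fun w => by
    obtain ⟨K, hK⟩ := hφ.holder w
    exact hK.continuous hα
  have hn : ∀ w, 0 < degree (f w) := fun w => (Nat.zero_le _).trans_lt (hexp.q_lt_degree w)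
  have hpair : ∀ w x y, HasPairing (f w) (degree (f w))
      (((degree (f w) : ℝ) - q w) * (σ w)⁻¹ + q w * L w) x y := fun w x y => by
    obtain ⟨𝒰, h𝒰, -, 𝒱, h𝒱, hcard, hA⟩ := hexp.covering w
    exact hasPairing_of_covering hgeo (hf.localHomeo w) (hf.inverse_lipschitz w)
      ((inv_le_one_of_one_le₀ (hexp.one_lt_sigma w).le).trans (hexp.one_le_L w))
      (hexp.lip_le_on_region w) (fun x hx => (hexp.lip_lt_off_region w x hx).le) hcard
      (fun U hU => (h𝒰 U (h𝒱 hU)).2) hA x y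
  have hosc := fun w => exp_sub_exp_le (hIV w).2
  have hdiam : ∀ x y : M, dist x y ≤ Metric.diam (univ : Set M) := fun x y =>
    Metric.dist_le_diam_of_mem isCompact_univ.isBounded (mem_univ x) (mem_univ y)
  set D := Metric.diam (univ : Set M)
  have hD0 : 0 ≤ D := Metric.diam_nonneg
  obtain ⟨w₀⟩ : Nonempty X := nonempty_of_isProbabilityMeasure P
  have hγ0 : 0 ≤ γ := (coneConst_nonneg (hexp.q_lt_degree w₀) (hexp.one_lt_sigma w₀)
    (hexp.one_le_L w₀) hε hm.1 hD0).trans (hV w₀)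
  -- Concavity of `t ↦ t^β` in the cone estimate requires an exponent at most one, hence the two
  -- cases.
  rcases le_or_gt α 1 with hα1 | hα1
  · refine exists_reference_density_of_meanContracting (β₀ := α) (E := ε) hθP (fun w => ?_) hγ0 hγ
      hf.measurable hfc hφ.measurable hα hα1 hε.le
      (fun w => sub_le_of_exp_sub_exp_le hε.le (hφc w) (hosc w))
      fun ν h K hK _ hh w => ⟨⟨K, hK⟩, holderWith_of_sub_le fun x y => hh w x y⟩
    refine meanContracting_of_hasPairing (hφc w) (hn w) (u := ε * D ^ (α : ℝ)) (by positivity)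
      (hpair w) (fun x => ?_) (mean_cost_le_of_le_one (hexp.q_lt_degree w) (hexp.one_lt_sigma w)
        (hexp.one_le_L w) (hexp.L_le_two w) hε hm.1 hD0 hα1 hγ (hV w))
    obtain ⟨z, hz, -⟩ := exists_eq_iInf_of_continuous (hφc w)
    have h1 := hosc w x z
    rw [← hz] at h1
    have h2 : ε * Real.exp (⨅ x, φ w x) * dist x z ^ (α : ℝ) ≤
        ε * Real.exp (⨅ x, φ w x) * D ^ (α : ℝ) := by
      gcongr
      exact hdiam x z
    linarith
  · have hα1' : (1 : ℝ) < α := hα1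
    have hφconst : ∀ w x y, φ w x = φ w y := fun w =>
      eq_of_memHolder_of_one_lt hgeo hα1 (hφ.holder w)
    have hg : ∀ w, MeanContracting (f w) (φ w) (γ ^ (1 / (α : ℝ))) := fun w =>
      meanContracting_of_hasPairing (hφc w) (hn w) le_rfl (hpair w)
        (fun x => by
          obtain ⟨z, hz, -⟩ := exists_eq_iInf_of_continuous (hφc w)
          rw [hz, hφconst w x z, add_zero, one_mul])
        (by
          rw [add_zero, one_mul]
          exact mean_cost_le_of_one_le (hexp.q_lt_degree w) (hexp.one_lt_sigma w)
            (hexp.one_le_L w) hε hm.1 hD0 hα1.le (hV w))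
    refine exists_reference_density_of_meanContracting (β₀ := 1) (E := 0) hθP hg
      (Real.rpow_nonneg hγ0 _) (Real.rpow_lt_one hγ0 hγ (by positivity))
      hf.measurable hfc hφ.measurable one_pos le_rfl le_rfl
      (fun w x y => by rw [hφconst w x y, sub_self, zero_mul])
      fun ν h K hK hlim _ w => ?_
    -- The general result would only give a Lipschitz density. Iterates of `1` are constant on
    -- fibres here, and so is their limit.
    have hconst : ∀ x y, h w x = h w y := fun x y => by
      refine tendsto_nhds_unique (hlim w x) ((hlim w y).congr fun n => ?_)
      unfold normalizedIter
      rw [iterTransfer_eq_of_const hg hφconst n _ (fun _ _ => rfl) x y]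
    obtain ⟨x₀⟩ : Nonempty M := inferInstance
    rw [show h w = fun _ => h w x₀ from funext fun x => hconst x x₀]
    exact memHolder_const
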